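/- Let $\mathbb{N}=\{0,1,2,\dots\}$, $[k]=\{0,1,\dots,k-1\}$, and let $n,r\ge 0$ be integers. The rank of a point $x\in\mathbb{N}^n$ is its number of nonzero coordinates; $\mathbb{N}^n_r$ is the set of points of $\mathbb{N}^n$ of rank $r$, and $[k]^n_r=[k]^n\cap\mathbb{N}^n_r$. The $d$-shadow $d(A)$ of a set $A\subseteq\mathbb{N}^n$ is the set of all points obtained from a point of $A$ by changing exactly one nonzero coordinate to $0$. For $x\in\mathbb{N}^n$ put $R_i(x)=\{j: x_j=i\}$, and write $x\le y$ if $x=y$, or $|R_0(x)|>|R_0(y)|$, or $|R_0(x)|=|R_0(y)|$ and, for the largest $i$ with $R_i(x)\ne R_i(y)$, one has $\max\big(R_i(x)\,\Delta\,R_i(y)\big)\in R_i(y)$. An initial segment of $S\subseteq\mathbb{N}^n$ is a subset $B\subseteq S$ such that $x\in S$, $y\in B$ and $x\le y$ imply $x\in B$. (1) For every $k$ and every $A\subseteq[k]^n_r$ there is exactly one initial segment $B$ of $[k]^n_r$ with $|B|=|A|$, and it satisfies $|d(A)|\ge|d(B)|$. (2) For every finite $A\subseteq\mathbb{N}^n_r$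 there is exactly one finite initial segment $C$ of $\mathbb{N}^n_r$ with $|C|=|A|$, and it satisfies $|d(A)|\ge|d(C)|$. (3) In particular, for every $t$ the set $[t]^n_r$ is an initial segment of $\mathbb{N}^n_r$ (and of $[k]^n_r$ for every $k\ge t$), and $|d(A)|\ge|d([t]^n_r)|$ for every $A\subseteq\mathbb{N}^n_r$ with $|A|=|[t]^n_r|$. -/

import Mathlib

namespace GridShadow

/-- `R i x` is the set of positions at which the point `x` takes the value `i`. -/
def R {n : ℕ} (i : ℕ) (x : Fin n → ℕ) : Finset (Fin n) :=
  Finset.univ.filter fun j => x j = i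

/-- The rank of a point: the number of its nonzero coordinates. -/
def rank {n : ℕ} (x : Fin n → ℕ) : ℕ :=
  (Finset.univ.filter fun j => 1 ≤ x j).card

/-- `[k]^n_r`: the points with all coordinates in `{0, …, k - 1}` and rank `r`. -/
def grid (k n r : ℕ) : Finset (Fin n → ℕ) :=
  (Fintype.piFinset fun _ : Fin n => Finset.range k).filter fun x => rank x = r

/-- `ℕ^n_r`: the points of `ℕ^n` of rank `r`. -/
def natGrid (n r : ℕ) : Set (Fin n → ℕ) :=
  {x | rank x = r}

/-- The order `x ≤ y`: either `x = y`, or `x` has more zeros than `y`, or they have equally many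
zeros and, for the largest `i` with `R i x ≠ R i y`, the maximum of the symmetric difference of
`R i x` and `R i y` belongs to `R i y`. -/
def le {n : ℕ} (x y : Fin n → ℕ) : Prop :=
  x = y ∨ (R 0 y).card < (R 0 x).card ∨
    ((R 0 x).card = (R 0 y).card ∧
      ∃ i : ℕ, IsGreatest {i' : ℕ | R i' x ≠ R i' y} i ∧
        ∃ m : Fin n, IsGreatest (↑(symmDiff (R i x) (R i y)) : Set (Fin n)) m ∧ m ∈ R i y)

/-- The `d`-shadow: all points obtained from a point of `A` by changing one nonzero coordinate
to `0`. -/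
def shadow {n : ℕ} (A : Finset (Fin n → ℕ)) : Finset (Fin n → ℕ) :=
  A.biUnion fun x => (Finset.univ.filter fun j => x j ≠ 0).image fun j => Function.update x j 0

/-- `B` is a (finite) initial segment of the restriction of the order to `S`. -/
def IsInitialSegment {n : ℕ} (S : Set (Fin n → ℕ)) (B : Finset (Fin n → ℕ)) : Prop :=
  ↑B ⊆ S ∧ ∀ y ∈ B, ∀ x ∈ S, le x y → x ∈ B

end GridShadow

namespace GridShadow

/-! On points of equal rank the order compares sets of keys `(x j, j)`: the larger point owns the
largest key not common to both. Reading keys as binary digits (`code`) embeds it in the natural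
numbers. Any two initial segments are nested.

The extremal statement `segMinimizes` goes by induction on the dimension. Fix a coordinate and
replace each slice of `A` by the segment of the same size. By the induction hypothesis, and because
shadows of segments are again segments (`IsSeg.shadow`), the shadow does not grow
(`card_shadow_le_of_slices`). The sum of codes drops unless `A` is already `Stable`, so one may
assume stability.

Every shadow point `q` has a least lift, obtained by putting `1` at its first zero. Segments contain
the least lifts of their shadow points, and so do stable sets in dimension at least 3. Hence the
shadow has size `∑ weight a`, where `weight a` counts the `q` with least lift `a`
(`card_shadow_eq_sum_weight`). It remains to compare weights on `C \ A` and `A \ C`. A point `x` of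
the former and `y` of the latter form a `Gap`: they disagree everywhere, and no point between them
shares a coordinate with each. Below full rank this forces `weight x ≤ weight y` (`Gap.weight_le`).
In full rank at most one `x` has positive weight, equal to `1`, and counting then yields a `y` of
positive weight (`sum_weight_le_of_full_rank`).

Rank at most 1 is immediate. Rank 2 in the plane compares `a + b` with `a * b`
(`card_shadow_le_two`). -/

/-! ### The order in terms of keys and binary codes -/

/-- The pair `(x j, j)`, ordered lexicographically. -/
def key {n : ℕ} (x : Fin n → ℕ) (j : Fin n) : ℕ ×ₗ Fin n := toLex (x j, j)

theorem key_lt_iff {n : ℕ} {x y : Fin n → ℕ} {i j : Fin n} :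
    key x i < key y j ↔ x i < y j ∨ x i = y j ∧ i < j := Prod.Lex.toLex_lt_toLex

theorem key_le_iff {n : ℕ} {x y : Fin n → ℕ} {i j : Fin n} :
    key x i ≤ key y j ↔ x i < y j ∨ x i = y j ∧ i ≤ j := Prod.Lex.toLex_le_toLex

theorem key_inj {n : ℕ} {x y : Fin n → ℕ} {i j : Fin n} (h : key x i = key y j) :
    i = j ∧ x i = y j := by
  have := congrArg ofLex h
  simp only [key, ofLex_toLex, Prod.mk.injEq] at this
  exact ⟨this.2, this.1⟩

/-- The strict order: the largest key that belongs to exactly one of `x`, `y` belongs to `y`. -/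
def Lt {n : ℕ} (x y : Fin n → ℕ) : Prop :=
  ∃ l, x l < y l ∧ ∀ j, x j ≠ y j → key x j < key y l ∧ key y j ≤ key y l

/-- A natural number whose binary digits record the keys of `x`. -/
def code {n : ℕ} (x : Fin n → ℕ) : ℕ := ∑ j, 2 ^ (x j * n + j)

theorem digit_lt {n : ℕ} {x y : Fin n → ℕ} {i j : Fin n} (h : key x i < key y j) :
    x i * n + i < y j * n + j := by
  rcases key_lt_iff.1 h with h | ⟨h, h'⟩
  · have := i.2
    nlinarith
  · rw [h]
    have : (i : ℕ) < j := h'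
    omega

theorem digit_inj {n : ℕ} {x : Fin n → ℕ} :
    Function.Injective fun j : Fin n => x j * n + (j : ℕ) := by
  intro i j h
  rcases lt_trichotomy (key x i) (key x j) with h' | h' | h'
  · exact absurd h (digit_lt h').ne
  · exact (key_inj h').1
  · exact absurd h (digit_lt h').ne'

/-- Agreeing positions contribute equally. The remaining digits of `x` are distinct and all lie
below the deciding digit of `y`, and a sum of distinct smaller powers of 2 stays below that power.
-/
theorem code_lt_of_lt {n : ℕ} {x y : Fin n → ℕ} (h : Lt x y) : code x < code y := by
  obtain ⟨l, hl, h⟩ := h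
  classical
  set D := Finset.univ.filter fun j => x j ≠ y j
  have split (z : Fin n → ℕ) : code z = ∑ j ∈ D, 2 ^ (z j * n + j)
      + ∑ j ∈ Finset.univ.filter (fun j => ¬ x j ≠ y j), 2 ^ (z j * n + j) :=
    (Finset.sum_filter_add_sum_filter_not _ _ _).symm
  have e : ∑ j ∈ Finset.univ.filter (fun j => ¬ x j ≠ y j), 2 ^ (x j * n + j)
      = ∑ j ∈ Finset.univ.filter (fun j => ¬ x j ≠ y j), 2 ^ (y j * n + (j : ℕ)) := by
    refine Finset.sum_congr rfl fun j hj => ?_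
    rw [not_not.1 (Finset.mem_filter.1 hj).2]
  rw [split x, split y, e]
  refine Nat.add_lt_add_right (lt_of_lt_of_le ?_ (Finset.single_le_sum (f := fun j : Fin n =>
    2 ^ (y j * n + (j : ℕ))) (fun _ _ => Nat.zero_le _)
    (Finset.mem_filter.2 ⟨Finset.mem_univ l, hl.ne⟩))) _
  rw [← Finset.sum_image (f := fun k => 2 ^ k) (g := fun j : Fin n => x j * n + (j : ℕ))
    (digit_inj.injOn)]
  refine Nat.geomSum_lt le_rfl fun k hk => ?_
  obtain ⟨j, hj, rfl⟩ := Finset.mem_image.1 hk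
  exact digit_lt (h j (Finset.mem_filter.1 hj).2).1

theorem lt_or_lt_of_ne {n : ℕ} {x y : Fin n → ℕ} (h : x ≠ y) : Lt x y ∨ Lt y x := by
  classical
  obtain ⟨j, hj⟩ := Function.ne_iff.1 h
  have hD : (Finset.univ.filter fun j => x j ≠ y j).Nonempty := ⟨j, by simpa using hj⟩
  obtain ⟨l, hl, hmax⟩ := Finset.exists_max_image _ (fun j => max (key x j) (key y j)) hD
  simp only [Finset.mem_filter, Finset.mem_univ, true_and] at hl hmax
  rcases Nat.lt_or_gt_of_ne hl with hlt | hlt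
  · have hk : key x l < key y l := key_lt_iff.2 (Or.inl hlt)
    refine Or.inl ⟨l, hlt, fun i hi => ?_⟩
    have := hmax i hi
    rw [max_eq_right hk.le, max_le_iff] at this
    refine ⟨lt_of_le_of_ne this.1 fun he => ?_, this.2⟩
    obtain ⟨rfl, he⟩ := key_inj he
    exact hi he
  · have hk : key y l < key x l := key_lt_iff.2 (Or.inl hlt)
    refine Or.inr ⟨l, hlt, fun i hi => ?_⟩
    have := hmax i hi.symm
    rw [max_eq_left hk.le, max_le_iff] at this
    refine ⟨lt_of_le_of_ne this.2 fun he => ?_, this.1⟩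
    obtain ⟨rfl, he⟩ := key_inj he
    exact hi he

theorem lt_iff_code_lt {n : ℕ} {x y : Fin n → ℕ} : Lt x y ↔ code x < code y := by
  refine ⟨code_lt_of_lt, fun h => ?_⟩
  rcases lt_or_lt_of_ne (x := x) (y := y) (by rintro rfl; exact h.false) with h' | h'
  · exact h'
  · exact absurd (code_lt_of_lt h') h.not_gt

theorem code_injective {n : ℕ} : Function.Injective (code (n := n)) := by
  intro x y h
  by_contra hne
  rcases lt_or_lt_of_ne hne with h' | h' <;> have := code_lt_of_lt h' <;> omega

theorem Lt.asymm {n : ℕ} {x y : Fin n → ℕ} (h : Lt x y) : ¬ Lt y x := fun h' =>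
  (code_lt_of_lt h).asymm (code_lt_of_lt h')

theorem Lt.ne {n : ℕ} {x y : Fin n → ℕ} (h : Lt x y) : x ≠ y := by
  rintro rfl
  exact h.asymm h

theorem rank_eq {n : ℕ} (x : Fin n → ℕ) :
    rank x = (Finset.univ.filter fun j => x j ≠ 0).card := by
  simp only [rank, Nat.one_le_iff_ne_zero]

theorem card_zeros_add_rank {n : ℕ} (x : Fin n → ℕ) : (R 0 x).card + rank x = n := by
  rw [rank_eq, R, Finset.card_filter_add_card_filter_not, Finset.card_univ, Fintype.card_fin]

/-- Taking the largest value whose level sets differ, and then the largest position in their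
difference, picks out the lexicographically largest key not common to both points. -/
theorem le_of_lt {n : ℕ} {x y : Fin n → ℕ} (hr : rank x = rank y) (h : Lt x y) : le x y := by
  obtain ⟨l, hl, h⟩ := h
  refine Or.inr (Or.inr ⟨?_, y l, ⟨?_, ?_⟩, l, ⟨?_, ?_⟩, ?_⟩)
  · have h1 := card_zeros_add_rank x
    have h2 := card_zeros_add_rank y
    omega
  · intro he
    have : l ∈ R (y l) x := by rw [he]; simp [R]
    simp only [R, Finset.mem_filter] at this
    exact hl.ne this.2
  · intro i hi
    by_contra! hlt
    refine hi (Finset.ext fun j => ?_)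
    simp only [R, Finset.mem_filter, Finset.mem_univ, true_and]
    by_cases hj : x j = y j
    · rw [hj]
    · have h1 := key_lt_iff.1 (h j hj).1
      have h2 := key_le_iff.1 (h j hj).2
      omega
  · simp only [Finset.coe_symmDiff, R, Finset.coe_filter, Set.mem_symmDiff]
    right
    simp [hl.ne]
  · intro j hj
    simp only [Finset.coe_symmDiff, R, Finset.coe_filter, Set.mem_symmDiff, Finset.mem_univ,
      true_and, Set.mem_ofPred_eq] at hj
    have hne : x j ≠ y j := by rintro he; rw [he] at hj; tauto
    have h1 := key_lt_iff.1 (h j hne).1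
    have h2 := key_le_iff.1 (h j hne).2
    rcases hj with hj | hj
    · rcases h1 with h1 | h1
      · omega
      · exact h1.2.le
    · rcases h2 with h2 | h2
      · omega
      · exact h2.2
  · simp [R]

theorem le_iff {n : ℕ} {x y : Fin n → ℕ} (hr : rank x = rank y) : le x y ↔ x = y ∨ Lt x y := by
  refine ⟨fun h => ?_, ?_⟩
  · by_contra! hn
    have hlt : Lt y x := (lt_or_lt_of_ne hn.1).resolve_left hn.2
    have hc : (R 0 x).card = (R 0 y).card := by
      have h1 := card_zeros_add_rank x
      have h2 := card_zeros_add_rank y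
      omega
    rcases h with h | h | ⟨-, i, hi, m, hm, hmi⟩
    · exact hn.1 h
    · omega
    rcases le_of_lt hr.symm hlt with h | h | ⟨-, i', hi', m', hm', hmi'⟩
    · exact hn.1 h.symm
    · omega
    simp only [ne_comm] at hi'
    obtain rfl := hi.unique hi'
    rw [symmDiff_comm] at hm'
    obtain rfl := hm.unique hm'
    have := hm.1
    rw [Finset.mem_coe, Finset.mem_symmDiff] at this
    tauto
  · rintro (rfl | h)
    · exact Or.inl rfl
    · exact le_of_lt hr h

/-! ### Initial segments: nesting, uniqueness, existence -/

/-- Finite initial segments of `ℕ^n_r` for the strict order. -/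
def IsSeg {n : ℕ} (r : ℕ) (C : Finset (Fin n → ℕ)) : Prop :=
  (∀ x ∈ C, rank x = r) ∧ ∀ y ∈ C, ∀ x, rank x = r → Lt x y → x ∈ C

theorem isInitialSegment_natGrid_iff {n r : ℕ} {C : Finset (Fin n → ℕ)} :
    IsInitialSegment (natGrid n r) C ↔ IsSeg r C := by
  refine ⟨fun h => ⟨fun x hx => h.1 hx, fun y hy x hx hxy => h.2 y hy x hx
    (le_of_lt (hx.trans (h.1 hy).symm) hxy)⟩,
    fun h => ⟨fun x hx => h.1 x hx, fun y hy x hx hxy => ?_⟩⟩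
  rcases (le_iff ((show rank x = r from hx).trans (h.1 y hy).symm)).1 hxy with rfl | hxy
  · exact hy
  · exact h.2 y hy x hx hxy

theorem IsSeg.subset_or_subset {n r : ℕ} {C D : Finset (Fin n → ℕ)} (hC : IsSeg r C)
    (hD : IsSeg r D) : C ⊆ D ∨ D ⊆ C := by
  by_contra! h
  obtain ⟨⟨x, hx, hx'⟩, y, hy, hy'⟩ := And.imp Finset.not_subset.1 Finset.not_subset.1 h
  rcases lt_or_lt_of_ne (x := x) (y := y) (by rintro rfl; exact hx' hy) with h | h
  · exact hx' (hD.2 y hy x (hC.1 x hx) h)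
  · exact hy' (hC.2 x hx y (hD.1 y hy) h)

theorem IsSeg.subset_of_card_le {n r : ℕ} {C D : Finset (Fin n → ℕ)} (hC : IsSeg r C)
    (hD : IsSeg r D) (h : C.card ≤ D.card) : C ⊆ D := by
  rcases hC.subset_or_subset hD with h' | h'
  · exact h'
  · exact (Finset.eq_of_subset_of_card_le h' h).symm.subset

theorem IsSeg.eq_of_card_eq {n r : ℕ} {C D : Finset (Fin n → ℕ)} (hC : IsSeg r C)
    (hD : IsSeg r D) (h : C.card = D.card) : C = D :=
  Finset.eq_of_subset_of_card_le (hC.subset_of_card_le hD h.le) h.ge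

/-- Segments grow by repeatedly adjoining the missing point of least code; `A` guarantees that
points of rank `r` do not run out. -/
theorem exists_isSeg {n r : ℕ} (A : Finset (Fin n → ℕ)) (hA : ∀ x ∈ A, rank x = r) :
    ∃ C : Finset (Fin n → ℕ), IsSeg r C ∧ C.card = A.card := by
  classical
  suffices H : ∀ s ≤ A.card, ∃ C : Finset (Fin n → ℕ), IsSeg r C ∧ C.card = s from H _ le_rfl
  intro s
  induction s with
  | zero => exact fun _ => ⟨∅, ⟨by simp, by simp⟩, rfl⟩
  | succ s ih =>
    intro hs
    obtain ⟨C, hC, hCs⟩ := ih (by omega)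
    obtain ⟨a, ha, haC⟩ := Finset.exists_mem_notMem_of_card_lt_card (s := C) (t := A) (by omega)
    have hex : ∃ N x, code (n := n) x = N ∧ rank x = r ∧ x ∉ C := ⟨_, a, rfl, hA a ha, haC⟩
    obtain ⟨x, hxN, hx, hxC⟩ := Nat.find_spec hex
    refine ⟨insert x C, ⟨?_, ?_⟩, by rw [Finset.card_insert_of_notMem hxC, hCs]⟩
    · intro y hy
      rcases Finset.mem_insert.1 hy with rfl | hy
      · exact hx
      · exact hC.1 y hy
    · intro y hy z hz hzy
      refine Finset.mem_insert_of_mem ?_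
      rcases Finset.mem_insert.1 hy with rfl | hy
      · by_contra hzC
        exact Nat.find_min hex (hxN ▸ code_lt_of_lt hzy) ⟨z, rfl, hz, hzC⟩
      · exact hC.2 y hy z hz hzy

theorem mem_grid {k n r : ℕ} {x : Fin n → ℕ} : x ∈ grid k n r ↔ (∀ j, x j < k) ∧ rank x = r := by
  simp [grid]

/-- Where `x` disagrees with `y`, its key is below a key of `y`. This is why bounding the
coordinates cuts out a segment. -/
theorem Lt.bounded {n k : ℕ} {x y : Fin n → ℕ} (h : Lt x y) (hy : ∀ j, y j < k) (j : Fin n) :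
    x j < k := by
  obtain ⟨l, -, h⟩ := h
  by_cases hj : x j = y j
  · exact hj ▸ hy j
  · have h1 := key_lt_iff.1 (h j hj).1
    have := hy l
    omega

theorem isSeg_grid (k n r : ℕ) : IsSeg r (grid k n r) :=
  ⟨fun _ hx => (mem_grid.1 hx).2, fun _ hy _ hx hxy =>
    mem_grid.2 ⟨hxy.bounded (mem_grid.1 hy).1, hx⟩⟩

theorem isInitialSegment_grid_iff {k n r : ℕ} {B : Finset (Fin n → ℕ)} :
    IsInitialSegment ↑(grid k n r) B ↔ IsSeg r B ∧ B ⊆ grid k n r := by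
  rw [← isInitialSegment_natGrid_iff]
  have hg : (grid k n r : Set (Fin n → ℕ)) ⊆ natGrid n r := fun x hx => (mem_grid.1 hx).2
  have hs := isInitialSegment_natGrid_iff.2 (isSeg_grid k n r)
  exact ⟨fun h => ⟨⟨h.1.trans hg, fun y hy x hx hxy => h.2 y hy x (hs.2 y (h.1 hy) x hx hxy) hxy⟩,
    Finset.coe_subset.1 h.1⟩, fun h => ⟨Finset.coe_subset.2 h.2, fun y hy x hx hxy =>
      h.1.2 y hy x (hg hx) hxy⟩⟩

/-! ### Shadows, ranks and least lifts -/

theorem mem_shadow {n : ℕ} {A : Finset (Fin n → ℕ)} {q : Fin n → ℕ} :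
    q ∈ shadow A ↔ ∃ x ∈ A, ∃ j, x j ≠ 0 ∧ Function.update x j 0 = q := by
  simp [shadow]

theorem rank_eq_sum {n : ℕ} (x : Fin n → ℕ) : rank x = ∑ j, if x j = 0 then 0 else 1 := by
  rw [rank_eq, Finset.card_filter]
  exact Finset.sum_congr rfl fun j _ => by by_cases h : x j = 0 <;> simp [h]

theorem rank_update {n : ℕ} (x : Fin n → ℕ) (j : Fin n) (v : ℕ) :
    rank (Function.update x j v) + (if x j = 0 then 0 else 1)
      = rank x + (if v = 0 then 0 else 1) := by
  rw [rank_eq_sum, rank_eq_sum, ← Finset.add_sum_erase _ _ (Finset.mem_univ j),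
    ← Finset.add_sum_erase _ (fun j => if x j = 0 then 0 else 1) (Finset.mem_univ j)]
  have : ∑ i ∈ Finset.univ.erase j, (if Function.update x j v i = 0 then 0 else 1)
      = ∑ i ∈ Finset.univ.erase j, (if x i = 0 then 0 else 1) :=
    Finset.sum_congr rfl fun i hi => by rw [Function.update_of_ne (Finset.ne_of_mem_erase hi)]
  rw [this, Function.update_self]
  ring

theorem rank_update_of_ne {n : ℕ} {x : Fin n → ℕ} {j : Fin n} {v : ℕ} (hx : x j ≠ 0)
    (hv : v ≠ 0) : rank (Function.update x j v) = rank x := by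
  have := rank_update x j v
  simp only [hx, hv, if_false] at this
  omega

theorem rank_update_zero {n : ℕ} {x : Fin n → ℕ} {j : Fin n} (hx : x j ≠ 0) :
    rank (Function.update x j 0) + 1 = rank x := by
  have := rank_update x j 0
  simpa only [hx, if_false, if_true, add_zero] using this

theorem rank_update_of_eq_zero {n : ℕ} {x : Fin n → ℕ} {j : Fin n} {v : ℕ} (hx : x j = 0)
    (hv : v ≠ 0) : rank (Function.update x j v) = rank x + 1 := by
  have := rank_update x j v
  simpa only [hx, hv, if_false, if_true, add_zero] using this

theorem ne_zero_of_rank_eq {n : ℕ} {x y : Fin n → ℕ} (hr : rank x = rank y)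
    (h : ∀ j, x j ≠ 0 → y j ≠ 0) (j : Fin n) (hj : y j ≠ 0) : x j ≠ 0 := by
  rw [rank_eq, rank_eq] at hr
  have := Finset.eq_of_subset_of_card_le
    (Finset.monotone_filter_right Finset.univ (fun j _ => h j)) hr.ge
  have hm : j ∈ Finset.univ.filter fun j => y j ≠ 0 := by simpa using hj
  rw [← this] at hm
  simpa using hm

/-- `z` is the first coordinate at which `q` vanishes. -/
def IsFirstZero {n : ℕ} (q : Fin n → ℕ) (z : Fin n) : Prop := q z = 0 ∧ ∀ i < z, q i ≠ 0

theorem IsFirstZero.unique {n : ℕ} {q : Fin n → ℕ} {z z' : Fin n} (h : IsFirstZero q z)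
    (h' : IsFirstZero q z') : z = z' := by
  rcases lt_trichotomy z z' with hl | hl | hl
  · exact absurd h.1 (h'.2 _ hl)
  · exact hl
  · exact absurd h'.1 (h.2 _ hl)

theorem IsFirstZero.le {n : ℕ} {q : Fin n → ℕ} {z j : Fin n} (h : IsFirstZero q z)
    (hj : q j = 0) : z ≤ j := by
  by_contra! hl
  exact h.2 _ hl hj

theorem exists_isFirstZero {n : ℕ} {q : Fin n → ℕ} {j : Fin n} (hj : q j = 0) :
    ∃ z, IsFirstZero q z := by
  obtain ⟨z, hz, hmin⟩ := Finset.exists_min_image (Finset.univ.filter fun i => q i = 0) id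
    ⟨j, by simpa using hj⟩
  simp only [Finset.mem_filter, Finset.mem_univ, true_and, id] at hz hmin
  exact ⟨z, hz, fun i hi h => absurd (hmin i h) (not_le.2 hi)⟩

/-- A lift of `q` adds a single key `(v, j)` with `v` nonzero and `j` a zero of `q`; the smallest
such key is `(1, z)`. -/
theorem firstZero_lift_le {n : ℕ} {q : Fin n → ℕ} {z j : Fin n} {v : ℕ} (hz : IsFirstZero q z)
    (hj : q j = 0) (hv : v ≠ 0) :
    Function.update q z 1 = Function.update q j v ∨
      Lt (Function.update q z 1) (Function.update q j v) := by
  by_cases hzj : z = j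
  · subst hzj
    by_cases h1 : v = 1
    · exact Or.inl (by rw [h1])
    · right
      refine ⟨z, by simp only [Function.update_self]; omega, fun i hi => ?_⟩
      by_cases hiz : i = z
      · subst hiz
        exact ⟨key_lt_iff.2 (Or.inl (by simp only [Function.update_self]; omega)), le_rfl⟩
      · simp [hiz] at hi
  · right
    have hlt : z < j := lt_of_le_of_ne (hz.le hj) hzj
    refine ⟨j, ?_, fun i hi => ?_⟩
    · rw [Function.update_of_ne (Ne.symm hzj), Function.update_self]
      omega
    · rw [key_lt_iff, key_le_iff]
      simp only [Function.update_apply] at hi ⊢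
      have := hz.1
      by_cases hiz : i = z <;> by_cases hij : i = j <;> grind

/-- Least lifts are monotone; this makes the shadow of a segment a segment. Let `l` decide `p < q`.
-/
theorem lift_le_lift {n : ℕ} {p q : Fin n → ℕ} {z z' : Fin n} (hr : rank p = rank q)
    (hpq : Lt p q) (hz : IsFirstZero p z) (hz' : IsFirstZero q z') :
    Function.update p z 1 = Function.update q z' 1 ∨
      Lt (Function.update p z 1) (Function.update q z' 1) := by
  obtain ⟨l, hl, h⟩ := hpq
  simp only [key_lt_iff, key_le_iff] at h
  have hlz' : l ≠ z' := by
    rintro rfl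
    have := hz'.1
    omega
  have hpz := hz.1
  have hqz := hz'.1
  -- If `q l ≥ 2`, the added keys have value 1 and `l` still decides. Otherwise `p l = 0`, `q l =
  -- 1`, the points agree beyond `l`, and all disagreements are between 0 and 1.
  by_cases h2 : 2 ≤ q l
  · right
    refine ⟨l, ?_, fun i hi => ?_⟩
    · simp only [Function.update_apply]
      split_ifs <;> omega
    · rw [key_lt_iff, key_le_iff]
      simp only [Function.update_apply] at hi ⊢
      have := h i
      by_cases hiz : i = z <;> by_cases hij : i = z' <;> by_cases hil : i = l <;> grind
  · have hql : q l = 1 := by omega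
    have hpl : p l = 0 := by omega
    have hagree : ∀ j, l < j → p j = q j := by
      intro j hj
      by_contra hne
      have := h j hne
      grind
    have hdiff : ∀ j, p j ≠ q j → p j ≤ 1 ∧ q j ≤ 1 := by
      intro j hne
      have := h j hne
      grind
    -- If `l` is the first zero of `p`, the lift of `p` has no zero up to `l`; equality of ranks
    -- then makes the two lifts coincide. Otherwise both first zeros lie before `l`, which keeps
    -- deciding.
    by_cases hzl : z = l
    · subst hzl
      left
      have hsupp : ∀ j, Function.update q z' 1 j ≠ 0 → Function.update p z 1 j ≠ 0 := by
        intro j hj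
        rcases lt_trichotomy j z with hlt | rfl | hlt
        · rw [Function.update_of_ne hlt.ne]
          exact hz.2 j hlt
        · simp
        · rw [Function.update_of_ne hlt.ne', hagree j hlt]
          by_cases hjz : j = z'
          · have := hz'.le (j := j)
            by_contra hq
            subst hjz
            have hz0 : ∀ i, p i ≠ 0 → q i ≠ 0 := by
              intro i hi
              rcases lt_trichotomy i j with hlt' | rfl | hlt'
              · exact hz'.2 i hlt'
              · rwa [← hagree i hlt]
              · rwa [← hagree i (hlt.trans hlt')]
            exact ne_zero_of_rank_eq hr hz0 z (by omega) hpl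
          · rwa [Function.update_of_ne hjz] at hj
      have hs := ne_zero_of_rank_eq (by
        rw [rank_update_of_eq_zero hpz one_ne_zero, rank_update_of_eq_zero hqz one_ne_zero, hr])
        hsupp
      funext j
      have h1 := hsupp j
      have h2 := hs j
      have h3 := hdiff j
      simp only [Function.update_apply] at h1 h2 ⊢
      by_cases hiz : j = z <;> by_cases hij : j = z' <;> grind
    · right
      have hzlt : z < l := lt_of_le_of_ne (hz.le hpl) hzl
      have hzlt' : z' < l := by
        by_contra! hle
        have hz0 : ∀ i, p i ≠ 0 → q i ≠ 0 := by
          intro i hi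
          rcases lt_trichotomy i l with hlt' | rfl | hlt'
          · exact hz'.2 i (hlt'.trans_le hle)
          · omega
          · rwa [← hagree i hlt']
        exact ne_zero_of_rank_eq hr hz0 l (by omega) hpl
      refine ⟨l, ?_, fun i hi => ?_⟩
      · simp only [Function.update_apply]
        split_ifs <;> grind
      · rw [key_lt_iff, key_le_iff]
        simp only [Function.update_apply] at hi ⊢
        have := h i
        have := hdiff i
        have := hagree i
        by_cases hiz : i = z <;> by_cases hij : i = z' <;> by_cases hil : i = l <;> grind

theorem update_update_zero {n : ℕ} (x : Fin n → ℕ) (j : Fin n) :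
    Function.update (Function.update x j 0) j (x j) = x := by
  rw [Function.update_idem, Function.update_eq_self]

theorem IsSeg.lift_mem {n r : ℕ} {C : Finset (Fin n → ℕ)} (hC : IsSeg r C) {q : Fin n → ℕ}
    (hq : q ∈ shadow C) {z : Fin n} (hz : IsFirstZero q z) : Function.update q z 1 ∈ C := by
  obtain ⟨x, hx, j, hj, rfl⟩ := mem_shadow.1 hq
  have hr : rank (Function.update (Function.update x j 0) z 1) = r := by
    rw [rank_update_of_eq_zero hz.1 one_ne_zero, rank_update_zero hj, hC.1 x hx]
  have := firstZero_lift_le hz (j := j) (by simp) hj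
  rw [update_update_zero] at this
  rcases this with h | h
  · rw [h]; exact hx
  · exact hC.2 x hx _ hr h

theorem mem_shadow_of_lift {n : ℕ} {A : Finset (Fin n → ℕ)} {q : Fin n → ℕ} {z : Fin n} {v : ℕ}
    (hq : q z = 0) (hv : v ≠ 0) (h : Function.update q z v ∈ A) : q ∈ shadow A :=
  mem_shadow.2 ⟨_, h, z, by simpa using hv,
    by rw [Function.update_idem, ← hq, Function.update_eq_self]⟩

theorem rank_of_mem_shadow {n r : ℕ} {A : Finset (Fin n → ℕ)} (hA : ∀ x ∈ A, rank x = r)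
    {q : Fin n → ℕ} (hq : q ∈ shadow A) : rank q + 1 = r := by
  obtain ⟨x, hx, j, hj, rfl⟩ := mem_shadow.1 hq
  rw [rank_update_zero hj, hA x hx]

theorem exists_eq_zero_of_mem_shadow {n : ℕ} {A : Finset (Fin n → ℕ)} {q : Fin n → ℕ}
    (hq : q ∈ shadow A) : ∃ j, q j = 0 := by
  obtain ⟨x, hx, j, hj, rfl⟩ := mem_shadow.1 hq
  exact ⟨j, by simp⟩

/-- If `p` precedes a shadow point `q`, its least lift does not exceed that of `q`, which lies in
`C`. For `r = 0` the shadow is empty, so the truncated `r - 1` is harmless. -/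
theorem IsSeg.shadow {n r : ℕ} {C : Finset (Fin n → ℕ)} (hC : IsSeg r C) :
    IsSeg (r - 1) (shadow C) := by
  have hrk : ∀ q ∈ GridShadow.shadow C, rank q + 1 = r := fun q hq => rank_of_mem_shadow hC.1 hq
  refine ⟨fun q hq => by have := hrk q hq; omega, fun q hq p hp hpq => ?_⟩
  have hqr := hrk q hq
  obtain ⟨j, hj⟩ := exists_eq_zero_of_mem_shadow hq
  obtain ⟨z', hz'⟩ := exists_isFirstZero hj
  have hpr : rank p = rank q := by omega
  obtain ⟨i, hi⟩ : ∃ i, p i = 0 := by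
    by_contra! hne
    exact ne_zero_of_rank_eq hpr.symm (fun i _ => hne i) j (hne j) hj
  obtain ⟨z, hz⟩ := exists_isFirstZero hi
  have hmem := hC.lift_mem hq hz'
  refine mem_shadow_of_lift hz.1 one_ne_zero ?_
  rcases lift_le_lift hpr hpq hz hz' with h | h
  · rwa [h]
  · exact hC.2 _ hmem _ (by rw [rank_update_of_eq_zero hz.1 one_ne_zero]; omega) h

/-! ### Weights and stable sets -/

/-- The number of points of rank `rank a - 1` whose least lift is `a`. -/
def weight {n : ℕ} (a : Fin n → ℕ) : ℕ :=
  (Finset.univ.filter fun j => a j = 1 ∧ ∀ i < j, a i ≠ 0).card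

/-- A shadow point determines its first zero and its least lift, so it is counted by exactly one
pair `(a, j)`. -/
theorem card_shadow_eq_sum_weight {n : ℕ} {A : Finset (Fin n → ℕ)}
    (hA : ∀ q ∈ shadow A, ∀ z, IsFirstZero q z → Function.update q z 1 ∈ A) :
    (shadow A).card = ∑ a ∈ A, weight a := by
  classical
  simp only [weight]
  rw [← Finset.card_sigma]
  symm
  refine Finset.card_bij (fun p _ => Function.update p.1 p.2 0) ?_ ?_ ?_
  · rintro ⟨a, j⟩ h
    simp only [Finset.mem_sigma, Finset.mem_filter, Finset.mem_univ, true_and] at h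
    exact mem_shadow.2 ⟨a, h.1, j, by omega, rfl⟩
  · rintro ⟨a, j⟩ h ⟨b, i⟩ h' he
    simp only [Finset.mem_sigma, Finset.mem_filter, Finset.mem_univ, true_and] at h h' he
    have hz (a : Fin n → ℕ) (j : Fin n) (h : ∀ i < j, a i ≠ 0) :
        IsFirstZero (Function.update a j 0) j :=
      ⟨by simp, fun i hi => by rw [Function.update_of_ne hi.ne]; exact h i hi⟩
    have h1 := hz a j h.2.2
    rw [he] at h1
    obtain rfl := h1.unique (hz b i h'.2.2)
    have h2 := update_update_zero a j
    have h3 := update_update_zero b j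
    rw [he, h.2.1] at h2
    rw [h'.2.1] at h3
    rw [← h2, h3]
  · intro q hq
    obtain ⟨j, hj⟩ := exists_eq_zero_of_mem_shadow hq
    obtain ⟨z, hz⟩ := exists_isFirstZero hj
    refine ⟨⟨Function.update q z 1, z⟩, ?_, ?_⟩
    · simp only [Finset.mem_sigma, Finset.mem_filter, Finset.mem_univ, true_and,
        Function.update_self]
      exact ⟨hA q hq z hz, fun i hi => by rw [Function.update_of_ne hi.ne]; exact hz.2 i hi⟩
    · simp only [Function.update_idem]
      rw [← hz.1, Function.update_eq_self]

/-- `A` contains every predecessor of rank `r` of its points that shares a coordinate with them. -/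
def Stable {n : ℕ} (r : ℕ) (A : Finset (Fin n → ℕ)) : Prop :=
  ∀ y ∈ A, ∀ x, rank x = r → Lt x y → (∃ j, x j = y j) → x ∈ A

theorem exists_ne_ne {n : ℕ} (hn : 3 ≤ n) (a b : Fin n) : ∃ i, i ≠ a ∧ i ≠ b := by
  obtain ⟨i, -, hi⟩ := Finset.exists_mem_notMem_of_card_lt_card (s := {a, b})
    (t := (Finset.univ : Finset (Fin n)))
    (Finset.card_le_two.trans_lt (by rwa [Finset.card_univ, Fintype.card_fin]))
  exact ⟨i, by simpa using hi⟩

/-- Two lifts of `q` differ in at most two positions, so in dimension at least 3 they share a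
coordinate and stability applies. -/
theorem Stable.lift_mem {n r : ℕ} (hn : 3 ≤ n) {A : Finset (Fin n → ℕ)} (hA : Stable r A)
    (hr : ∀ x ∈ A, rank x = r) {q : Fin n → ℕ}
    (hq : q ∈ shadow A) {z : Fin n} (hz : IsFirstZero q z) : Function.update q z 1 ∈ A := by
  obtain ⟨x, hx, j, hj, rfl⟩ := mem_shadow.1 hq
  have hrk : rank (Function.update (Function.update x j 0) z 1) = r := by
    rw [rank_update_of_eq_zero hz.1 one_ne_zero, rank_update_zero hj, hr x hx]
  obtain ⟨i, hiz, hij⟩ := exists_ne_ne hn z j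
  have := firstZero_lift_le hz (j := j) (by simp) hj
  rw [update_update_zero] at this
  rcases this with h | h
  · rw [h]; exact hx
  · exact hA x hx _ hrk h ⟨i, by rw [Function.update_of_ne hiz, Function.update_of_ne hij]⟩

/-! ### Gaps, and weights below full rank -/

/-- A point `x` of rank `r` missing from the stable set `A`, a larger point `y` of `A`, and the
position `m` of the largest key of `y`. -/
structure Gap {n : ℕ} (r : ℕ) (A : Finset (Fin n → ℕ)) (x y : Fin n → ℕ) (m : Fin n) : Prop where
  stable : Stable r A
  rank_left : rank x = r
  rank_right : rank y = r
  notMem : x ∉ A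
  mem : y ∈ A
  lt : Lt x y
  top : ∀ j, key x j < key y m ∧ key y j ≤ key y m

namespace Gap

variable {n r : ℕ} {A : Finset (Fin n → ℕ)} {x y : Fin n → ℕ} {m : Fin n}

theorem ne (h : Gap r A x y m) (j : Fin n) : x j ≠ y j := fun hj =>
  h.notMem (h.stable y h.mem x h.rank_left h.lt ⟨j, hj⟩)

theorem lt_top (h : Gap r A x y m) : x m < y m := by
  have h1 := key_lt_iff.1 (h.top m).1
  have := h.ne m
  omega

/-- Such a `z` would pass membership from `y` to `z` and on to `x`. The structure of gaps is
obtained by exhibiting suitable `z`. -/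
theorem not_between (h : Gap r A x y m) {z : Fin n → ℕ} (hz : rank z = r) (hxz : Lt x z)
    (hzy : Lt z y) {i j : Fin n} (hi : z i = x i) (hj : z j = y j) : False :=
  h.notMem (h.stable z (h.stable y h.mem z hz hzy ⟨j, hj⟩) x h.rank_left hxz ⟨i, hi.symm⟩)

theorem lt_of_apply_top (h : Gap r A x y m) {z : Fin n → ℕ} (hm : z m = y m)
    (hz : ∀ j, key z j ≤ key y m) : Lt x z := by
  have hk : key z m = key y m := by rw [key, hm, key]
  exact ⟨m, hm ▸ h.lt_top, fun j _ => ⟨hk ▸ (h.top j).1, hk ▸ hz j⟩⟩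

theorem lt_right (h : Gap r A x y m) {z : Fin n → ℕ} (hz : ∀ j, key z j < key y m) :
    Lt z y := by
  refine ⟨m, ?_, fun j _ => ⟨hz j, (h.top j).2⟩⟩
  rcases key_lt_iff.1 (hz m) with h' | h'
  · exact h'
  · exact absurd h'.2 (lt_irrefl m)

/-- Otherwise `y` with entry `j` lowered to `x j` lies in between. -/
theorem lt_of_ne_zero (h : Gap r A x y m) {j : Fin n} (hj : j ≠ m) (hx : x j ≠ 0) :
    y j < x j := by
  by_contra! hle
  have hlt : x j < y j := lt_of_le_of_ne hle (h.ne j)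
  refine h.not_between (z := Function.update y j (x j)) (i := j) (j := m) ?_ ?_ ?_ (by simp)
    (Function.update_of_ne hj.symm _ _)
  · rw [rank_update_of_ne (by omega) hx, h.rank_right]
  · refine h.lt_of_apply_top (Function.update_of_ne hj.symm _ _) fun i => ?_
    by_cases hij : i = j
    · subst hij
      refine le_trans (key_le_iff.2 (Or.inl ?_)) (h.top i).2
      simpa using hlt
    · have := (h.top i).2
      rwa [key, Function.update_of_ne hij]
  · refine ⟨j, by simpa using hlt, fun i hi => ?_⟩
    by_cases hij : i = j
    · subst hij
      exact ⟨key_lt_iff.2 (Or.inl (by simpa using hlt)), le_rfl⟩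
    · simp [hij] at hi

/-- Let `z` be `y` with its entry at `j` erased and a 1 put at `j'`. It exceeds `x` and shares a
coordinate with each of `x` and `y`, so it cannot precede `y`; that is, `(1, j')` is not below `(y
j, j)`. -/
theorem swap (h : Gap r A x y m) {j j' : Fin n} (hj : j ≠ m) (hy : y j ≠ 0) (hy' : y j' = 0)
    (hx : x j = 0 ∨ x j' = 1) : y j = 1 ∧ j < j' := by
  have hjj' : j ≠ j' := by rintro rfl; exact hy hy'
  have hm : y m ≠ 0 := by have := h.lt_top; omega
  have hj'm : j' ≠ m := by rintro rfl; exact hm hy'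
  set z := Function.update (Function.update y j 0) j' 1 with hz
  have hzj : z j = 0 := by simp [hz, hjj']
  have hzj' : z j' = 1 := by simp [hz]
  have hzo (i : Fin n) (h1 : i ≠ j) (h2 : i ≠ j') : z i = y i := by simp [hz, h1, h2]
  have hzr : rank z = r := by
    rw [hz, rank_update_of_eq_zero (by rw [Function.update_of_ne hjj'.symm, hy']) one_ne_zero,
      rank_update_zero hy, h.rank_right]
  have hzm : z m = y m := hzo m hj.symm hj'm.symm
  have hxz : Lt x z := by
    refine h.lt_of_apply_top hzm fun i => ?_
    by_cases hij : i = j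
    · subst hij
      exact key_le_iff.2 (Or.inl (by omega))
    by_cases hij' : i = j'
    · subst hij'
      have h1 := (h.top i).1
      have h2 := h.ne i
      rw [key_lt_iff] at h1
      rw [key_le_iff]
      grind
    · have := (h.top i).2
      rwa [key, hzo i hij hij']
  have hno : ¬ Lt z y := fun hzy => by
    rcases hx with hx | hx
    · exact h.not_between hzr hxz hzy (hzj.trans hx.symm) hzm
    · exact h.not_between hzr hxz hzy (hzj'.trans hx.symm) hzm
  by_contra hcon
  refine hno ⟨j, by omega, fun i hi => ?_⟩
  rw [key_lt_iff, key_le_iff]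
  by_cases hij : i = j
  · subst hij
    omega
  by_cases hij' : i = j'
  · subst hij'
    grind
  · exact absurd (hzo i hij hij') hi

end Gap

theorem exists_eq_zero_of_rank_lt {n : ℕ} {x : Fin n → ℕ} (h : rank x < n) : ∃ j, x j = 0 := by
  by_contra! hne
  rw [rank_eq, Finset.filter_true_of_mem fun j _ => hne j, Finset.card_univ, Fintype.card_fin] at h
  exact h.false

theorem ne_zero_of_rank_eq_card {n : ℕ} {x : Fin n → ℕ} (h : rank x = n) (j : Fin n) :
    x j ≠ 0 := by
  intro hj
  have h1 := card_zeros_add_rank x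
  have : j ∈ R 0 x := by simpa [R] using hj
  have := Finset.card_pos.2 ⟨j, this⟩
  omega

theorem weight_pos {n : ℕ} {a : Fin n → ℕ} {j : Fin n} (h : a j = 1) (h' : ∀ i < j, a i ≠ 0) :
    1 ≤ weight a :=
  Finset.card_pos.2 ⟨j, by simpa using ⟨h, h'⟩⟩

theorem weight_le_one {n : ℕ} {a : Fin n → ℕ} (j : Fin n)
    (h : ∀ i, a i = 1 → (∀ l < i, a l ≠ 0) → i = j) : weight a ≤ 1 := by
  refine (Finset.card_le_card (t := {j}) fun i hi => ?_).trans_eq (Finset.card_singleton j)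
  simp only [Finset.mem_filter, Finset.mem_univ, true_and] at hi
  exact Finset.mem_singleton.2 (h i hi.1 hi.2)

theorem Gap.weight_le {n r : ℕ} {A : Finset (Fin n → ℕ)} {x y : Fin n → ℕ} {m : Fin n}
    (h : Gap r A x y m) (hn : 3 ≤ n) (hr : r < n) : weight x ≤ weight y := by
  obtain ⟨j0, hj0⟩ := exists_eq_zero_of_rank_lt (x := y) (h.rank_right ▸ hr)
  have hxy := h.ne
  have hm := h.lt_top
  -- A zero `j` of `x` off the top gives `y j = 1` before all zeros of `y`, so `y` has positive
  -- weight. A 1 of `x` off the top sits at a zero of `y`, hence after `j`, and does not count.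
  by_cases hJ : ∃ j, x j = 0 ∧ j ≠ m
  · obtain ⟨j, hj, hjm⟩ := hJ
    have hyj : y j ≠ 0 := by have := hxy j; omega
    have hz : ∀ i, y i = 0 → j < i := fun i hi => (h.swap hjm hyj hi (Or.inl hj)).2
    have hy1 := (h.swap hjm hyj hj0 (Or.inl hj)).1
    have hyw : 1 ≤ weight y := weight_pos hy1 fun i hi h0 => (hz i h0).not_gt hi
    refine (weight_le_one m fun i hi hl => ?_).trans hyw
    by_contra him
    have h1 := h.lt_of_ne_zero him (by omega)
    exact hl j (hz i (by omega)) hj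
  -- Now `m` is the only zero of `x`, so the rank is `n - 1` and `y` also has a single zero `j0`,
  -- the only place where `x` can be 1. If it is, `swap` at a third coordinate makes the weight of
  -- `y` positive.
  · push Not at hJ
    obtain ⟨i0, hi0⟩ := exists_eq_zero_of_rank_lt (x := x) (h.rank_left ▸ hr)
    obtain rfl := hJ i0 hi0
    have hxne : ∀ j, j ≠ i0 → x j ≠ 0 := fun j hj h0 => hj (hJ j h0)
    have hj0m : j0 ≠ i0 := by rintro rfl; omega
    have huniq : ∀ j, y j = 0 → j = j0 := by
      intro j hj
      by_contra hne
      have hrk : rank y = rank (Function.update (Function.update x i0 1) j0 0) := by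
        have h1 := rank_update_of_eq_zero hi0 one_ne_zero
        have h2 := rank_update_zero (x := Function.update x i0 1) (j := j0)
          (by rw [Function.update_of_ne hj0m]; exact hxne j0 hj0m)
        have := h.rank_left
        have := h.rank_right
        omega
      refine ne_zero_of_rank_eq hrk (fun i hi => ?_) j ?_ hj
      · have : i ≠ j0 := by rintro rfl; exact hi hj0
        rw [Function.update_of_ne this]
        by_cases hii : i = i0
        · subst hii; simp
        · rw [Function.update_of_ne hii]; exact hxne i hii
      · rw [Function.update_of_ne hne]
        by_cases hii : j = i0
        · subst hii; simp
        · rw [Function.update_of_ne hii]; exact hxne j hii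
    have hone : ∀ i, x i = 1 → i = j0 := fun i hi => by
      have him : i ≠ i0 := by rintro rfl; omega
      have := h.lt_of_ne_zero him (by omega)
      exact huniq i (by omega)
    by_cases hx1 : x j0 = 1
    · obtain ⟨j, hjm, hjj⟩ := exists_ne_ne hn i0 j0
      have hyj : y j ≠ 0 := fun h0 => hjj (huniq j h0)
      obtain ⟨h1, h2⟩ := h.swap hjm hyj hj0 (Or.inr hx1)
      have hyw : 1 ≤ weight y := weight_pos h1 fun i hi h0 => by
        rw [huniq i h0] at hi
        exact hi.asymm h2
      exact (weight_le_one j0 fun i hi _ => hone i hi).trans hyw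
    · have : weight x = 0 := by
        refine Finset.card_eq_zero.2 (Finset.filter_eq_empty_iff.2 fun i _ hi => hx1 ?_)
        rw [← hone i hi.1]; exact hi.1
      omega

/-! ### Stable sets of full rank -/

section

variable {n r : ℕ} {A : Finset (Fin n → ℕ)} {x y : Fin n → ℕ} {m : Fin n}

theorem exists_gap (hA : Stable r A) (hx : rank x = r) (hy : rank y = r) (hxA : x ∉ A)
    (hyA : y ∈ A) (h : Lt x y) : ∃ m, Gap r A x y m := by
  have hne : ∀ j, x j ≠ y j := fun j hj => hxA (hA y hyA x hx h ⟨j, hj⟩)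
  obtain ⟨m, -, hm⟩ := id h
  exact ⟨m, hA, hx, hy, hxA, hyA, h, fun j => hm j (hne j)⟩

/-- If this failed, `x` with entry `m` raised to `y m - 1` and entry `l` lowered to `y l` would lie
in between; the third coordinate is shared with `x`, and `l` with `y`. -/
theorem Gap.left_key_lt (h : Gap n A x y m) (hn : 3 ≤ n) (hxm : x m = 1) {l : Fin n}
    (hl : l ≠ m) : y m - 1 < x l ∨ y m - 1 = x l ∧ m < l := by
  have hx0 := ne_zero_of_rank_eq_card h.rank_left
  have hy0 := ne_zero_of_rank_eq_card h.rank_right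
  have hyl := h.lt_of_ne_zero hl (hx0 l)
  have hylp := hy0 l
  have htop := h.lt_top
  obtain ⟨i, him, hil⟩ := exists_ne_ne hn m l
  by_contra hcon
  set z := Function.update (Function.update x m (y m - 1)) l (y l) with hz
  have hzl : z l = y l := by simp [hz]
  have hzm : z m = y m - 1 := by simp [hz, hl.symm]
  have hzo (i : Fin n) (h1 : i ≠ m) (h2 : i ≠ l) : z i = x i := by simp [hz, h1, h2]
  have hzr : rank z = n := by
    rw [hz, rank_update_of_ne (by rw [Function.update_of_ne hl]; exact hx0 l) hylp,
      rank_update_of_ne (hx0 m) (by omega), h.rank_left]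
  refine h.not_between hzr ⟨m, by grind, fun j hj => ?_⟩ (h.lt_right fun j => ?_)
    (hzo i him hil) hzl
  · rw [key_lt_iff, key_le_iff]
    by_cases hjm : j = m
    · subst hjm; grind
    by_cases hjl : j = l
    · subst hjl; grind
    · exact absurd (hzo j hjm hjl).symm hj
  · have h1 := h.top j
    rw [key_lt_iff, key_le_iff] at h1
    rw [key_lt_iff]
    by_cases hjm : j = m
    · subst hjm; grind
    by_cases hjl : j = l
    · subst hjl; grind
    · rw [hzo j hjm hjl]; exact h1.1

/-- Off the top, `x j > y j ≥ 1`, so only the top position can carry a 1. -/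
theorem Gap.apply_top_eq_one (h : Gap n A x y m) (hw : 1 ≤ weight x) : x m = 1 := by
  obtain ⟨j, hj⟩ := Finset.card_pos.1 hw
  simp only [Finset.mem_filter, Finset.mem_univ, true_and] at hj
  by_cases hjm : j = m
  · rw [← hjm]; exact hj.1
  · have := h.lt_of_ne_zero hjm (by omega)
    have := ne_zero_of_rank_eq_card h.rank_right j
    omega

theorem Gap.weight_le_one (h : Gap n A x y m) : weight x ≤ 1 :=
  GridShadow.weight_le_one m fun j hj _ => by
    by_contra hjm
    have := h.lt_of_ne_zero hjm (by omega)
    have := ne_zero_of_rank_eq_card h.rank_right j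
    omega

theorem Gap.top_unique {x' : Fin n → ℕ} {m' : Fin n} (h : Gap r A x y m) (h' : Gap r A x' y m') :
    m = m' :=
  (key_inj (le_antisymm (h'.top m).2 (h.top m').2)).1

/-- For `l ≠ m` the key of `x` at `l` lies strictly between `(y m - 1, m)` and `(y m, m)`, which
leaves one value for each `l`. Thus `y` determines `x`. -/
theorem Gap.eq_of_weight_pos {x' : Fin n → ℕ} {m' : Fin n} (hn : 3 ≤ n) (h : Gap n A x y m)
    (h' : Gap n A x' y m') (hx : 1 ≤ weight x) (hx' : 1 ≤ weight x') : x = x' := by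
  obtain rfl := h.top_unique h'
  have hm := h.apply_top_eq_one hx
  have hm' := h'.apply_top_eq_one hx'
  funext l
  by_cases hl : l = m
  · rw [hl, hm, hm']
  · have h1 := h.left_key_lt hn hm hl
    have h2 := h'.left_key_lt hn hm' hl
    have h3 := key_lt_iff.1 (h.top l).1
    have h4 := key_lt_iff.1 (h'.top l).1
    grind

/-- Since `i` carries the least key of `s`, a comparison of `y` with `s` decided elsewhere survives
lowering that entry to 1. -/
theorem eq_update_of_between {y s : Fin n → ℕ} {i : Fin n} (hi : ∀ j, key s i ≤ key s j)
    (hsi : s i ≠ 0) (hys : Lt y s) (hy : ¬ Lt y (Function.update s i 1)) :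
    y = Function.update s i (y i) := by
  by_contra hne
  obtain ⟨j, hj⟩ := Function.ne_iff.1 hne
  have hji : j ≠ i := by rintro rfl; simp at hj
  rw [Function.update_of_ne hji] at hj
  obtain ⟨l, hl, h⟩ := hys
  have hli : l ≠ i := by
    rintro rfl
    exact hji (key_inj (le_antisymm (h j hj).2 (hi j))).1
  have hil : key s i < key s l := lt_of_le_of_ne (hi l) fun he => hli (key_inj he).1.symm
  refine hy ⟨l, by rwa [Function.update_of_ne hli], fun k hk => ?_⟩
  have hkl : key (Function.update s i 1) l = key s l := by rw [key, Function.update_of_ne hli, key]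
  rw [hkl]
  by_cases hki : k = i
  · subst hki
    constructor
    · by_cases he : y k = s k
      · rwa [key, he]
      · exact (h k he).1
    · refine le_trans (key_le_iff.2 ?_) hil.le
      rw [Function.update_self]
      rcases (Nat.one_le_iff_ne_zero.2 hsi).lt_or_eq with h1 | h1
      · grind
      · grind
  · rw [Function.update_of_ne hki] at hk
    have := h k hk
    exact ⟨this.1, by rw [key, Function.update_of_ne hki]; exact this.2⟩

/-- In full rank, a stable set differs from the initial segment of the same size only by points
of controlled weight. -/
theorem sum_weight_le_of_full_rank {C : Finset (Fin n → ℕ)} (hn : 3 ≤ n) (hA : Stable n A)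
    (hAr : ∀ x ∈ A, rank x = n) (hC : IsSeg n C) (hc : C.card = A.card) :
    ∑ x ∈ C \ A, weight x ≤ ∑ y ∈ A \ C, weight y := by
  have hcard : (C \ A).card = (A \ C).card := Finset.card_sdiff_comm hc
  have hlt : ∀ x ∈ C \ A, ∀ y ∈ A \ C, Lt x y := by
    intro x hx y hy
    rw [Finset.mem_sdiff] at hx hy
    refine (lt_or_lt_of_ne (x := x) (y := y) (by rintro rfl; exact hx.2 hy.1)).resolve_right
      fun h => hy.2 (hC.2 x hx.1 y (hAr y hy.1) h)
  have hgap : ∀ x ∈ C \ A, ∀ y ∈ A \ C, ∃ m, Gap n A x y m := by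
    intro x hx y hy
    have h := hlt x hx y hy
    rw [Finset.mem_sdiff] at hx hy
    exact exists_gap hA (hC.1 x hx.1) (hAr y hy.1) hx.2 hy.1 h
  by_cases hX : ∃ x ∈ C \ A, 1 ≤ weight x
  swap
  · push Not at hX
    rw [Finset.sum_eq_zero fun x hx => by have := hX x hx; omega]
    exact Nat.zero_le _
  obtain ⟨x, hx, hwx⟩ := hX
  obtain ⟨s, hs, hsmax⟩ := Finset.exists_max_image (A \ C) code
    (Finset.card_pos.1 (hcard ▸ Finset.card_pos.2 ⟨x, hx⟩))
  obtain ⟨m, h⟩ := hgap x hx s hs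
  have hsum : ∑ x ∈ C \ A, weight x ≤ 1 := by
    rw [Finset.sum_eq_single_of_mem x hx fun x' hx' hne => ?_]
    · exact h.weight_le_one
    · obtain ⟨m', h'⟩ := hgap x' hx' s hs
      by_contra hw
      exact hne (h'.eq_of_weight_pos hn h (by omega) hwx)
  refine hsum.trans ?_
  suffices hY : ∃ y ∈ A \ C, 1 ≤ weight y by
    obtain ⟨y, hy, hw⟩ := hY
    exact hw.trans (Finset.single_le_sum (f := weight) (fun _ _ => Nat.zero_le _) hy)
  have hxm := h.apply_top_eq_one hwx
  have hx0 := ne_zero_of_rank_eq_card h.rank_left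
  have hs0 := ne_zero_of_rank_eq_card h.rank_right
  have htop := h.lt_top
  -- Lower the entry of least key in `s`, the largest point of `A \ C`, to 1. The result `L` is in
  -- `A`, as it keeps the top entry; if it is not in `C`, it is the required point of positive
  -- weight.
  obtain ⟨i, -, hi⟩ := Finset.exists_min_image Finset.univ (key s) ⟨m, Finset.mem_univ m⟩
  replace hi : ∀ j, key s i ≤ key s j := fun j => hi j (Finset.mem_univ j)
  have him : i ≠ m := by
    rintro rfl
    obtain ⟨k, hk, -⟩ := exists_ne_ne hn i i
    exact hk (key_inj (le_antisymm (h.top k).2 (hi k))).1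
  have hsi : s i < s m := by
    have h1 := h.lt_of_ne_zero him (hx0 i)
    have h2 := key_lt_iff.1 (h.top i).1
    omega
  set L := Function.update s i 1 with hL
  have hLm : L m = s m := by rw [hL, Function.update_of_ne him.symm]
  have hLr : rank L = n := by rw [hL, rank_update_of_ne (hs0 i) one_ne_zero, h.rank_right]
  have hLs : L = s ∨ Lt L s := by
    by_cases h1 : s i = 1
    · left; rw [hL, ← h1, Function.update_eq_self]
    · right
      have := hs0 i
      refine ⟨i, by rw [hL, Function.update_self]; omega, fun j hj => ?_⟩
      by_cases hji : j = i
      · subst hji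
        exact ⟨key_lt_iff.2 (Or.inl (by rw [hL, Function.update_self]; omega)), le_rfl⟩
      · rw [hL, Function.update_of_ne hji] at hj
        exact absurd rfl hj
  have hLA : L ∈ A := by
    rcases hLs with hLs | hLs
    · rw [hLs]; exact h.mem
    · exact hA s h.mem L hLr hLs ⟨m, hLm⟩
  by_cases hLC : L ∈ C
  swap
  · exact ⟨L, Finset.mem_sdiff.2 ⟨hLA, hLC⟩, weight_pos (j := i) (by rw [hL, Function.update_self])
      fun k _ => ne_zero_of_rank_eq_card hLr k⟩
  exfalso
  -- If `L ∈ C`, counting gives a contradiction: `C \ A` has at least `s m - 1` points, namely `x`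
  -- with its top entry varied, while `A \ C` lies between `L` and `s` and has at most `s i - 1`
  -- points; but `s i < s m`.
  have hX : (Finset.Ico 1 (s m)).image (fun u => Function.update x m u) ⊆ C \ A := by
    intro t ht
    obtain ⟨u, hu, rfl⟩ := Finset.mem_image.1 ht
    rw [Finset.mem_Ico] at hu
    have hur : rank (Function.update x m u) = n := by
      rw [rank_update_of_ne (hx0 m) (by omega), h.rank_left]
    rw [Finset.mem_sdiff]
    constructor
    · refine hC.2 L hLC _ hur ⟨m, by rw [Function.update_self, hLm]; exact hu.2, fun j _ => ?_⟩
      have hkm : key L m = key s m := by rw [key, hLm, key]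
      rw [hkm]
      constructor
      · by_cases hj : j = m
        · subst hj
          exact key_lt_iff.2 (Or.inl (by rw [Function.update_self]; exact hu.2))
        · rw [key, Function.update_of_ne hj]; exact (h.top j).1
      · refine le_trans (key_le_iff.2 ?_) (h.top j).2
        by_cases hj : j = i
        · subst hj
          rw [hL, Function.update_self]
          rcases (Nat.one_le_iff_ne_zero.2 (hs0 j)).lt_or_eq with h1 | h1
          · exact Or.inl h1
          · exact Or.inr ⟨h1, le_rfl⟩
        · rw [hL, Function.update_of_ne hj]
          exact Or.inr ⟨rfl, le_rfl⟩
    · intro hmem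
      by_cases hu1 : u = 1
      · rw [hu1, ← hxm, Function.update_eq_self] at hmem
        exact h.notMem hmem
      · refine h.notMem (hA _ hmem x h.rank_left ⟨m, by rw [Function.update_self]; omega,
          fun j hj => ?_⟩ ⟨i, by rw [Function.update_of_ne him]⟩)
        by_cases hjm : j = m
        · subst hjm
          exact ⟨key_lt_iff.2 (Or.inl (by rw [Function.update_self]; omega)), le_rfl⟩
        · rw [Function.update_of_ne hjm] at hj
          exact absurd rfl hj
  have hY : A \ C ⊆ (Finset.Ioc 1 (s i)).image fun u => Function.update s i u := by
    intro y hy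
    rw [Finset.mem_image]
    have hyr := hAr y (Finset.mem_sdiff.1 hy).1
    by_cases hys : y = s
    · subst hys
      refine ⟨y i, Finset.mem_Ioc.2 ⟨?_, le_rfl⟩, Function.update_eq_self i y⟩
      have := hs0 i
      by_contra hle
      have h1 : y i = 1 := by omega
      rw [hL, ← h1, Function.update_eq_self] at hLC
      exact (Finset.mem_sdiff.1 hs).2 hLC
    · have hlt : Lt y s := (lt_or_lt_of_ne hys).resolve_right fun hsy =>
        (hsmax y hy).not_gt (code_lt_of_lt hsy)
      have hyL : ¬ Lt y L := fun hyL => (Finset.mem_sdiff.1 hy).2 (hC.2 L hLC y hyr hyL)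
      have he := eq_update_of_between hi (hs0 i) hlt hyL
      refine ⟨y i, Finset.mem_Ioc.2 ⟨?_, ?_⟩, he.symm⟩
      · have := ne_zero_of_rank_eq_card hyr i
        by_contra hle
        have h1 : y i = 1 := by omega
        rw [h1, ← hL] at he
        exact (Finset.mem_sdiff.1 hy).2 (he ▸ hLC)
      · obtain ⟨l, hl, -⟩ := hlt
        rw [he] at hl
        by_cases hli : l = i
        · subst hli
          rw [Function.update_self] at hl
          exact hl.le
        · rw [Function.update_of_ne hli] at hl
          exact absurd hl (lt_irrefl _)
  have h1 := Finset.card_le_card hX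
  have h2 := (Finset.card_le_card hY).trans Finset.card_image_le
  rw [Finset.card_image_of_injective _ (Function.update_injective x m), Nat.card_Ico] at h1
  rw [Nat.card_Ioc] at h2
  have := hs0 i
  omega

theorem sum_le_sum_of_forall_le {α : Type*} {X Y : Finset α} {f : α → ℕ} (h : X.card = Y.card)
    (hf : ∀ x ∈ X, ∀ y ∈ Y, f x ≤ f y) : ∑ x ∈ X, f x ≤ ∑ y ∈ Y, f y := by
  rcases Y.eq_empty_or_nonempty with rfl | hY
  · rw [Finset.card_eq_zero.1 (h.trans Finset.card_empty)]
  · obtain ⟨y, hy, hmin⟩ := Finset.exists_min_image Y f hY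
    calc ∑ x ∈ X, f x ≤ X.card • f y := Finset.sum_le_card_nsmul _ _ _ fun x hx => hf x hx y hy
      _ = Y.card • f y := by rw [h]
      _ ≤ _ := Finset.card_nsmul_le_sum _ _ _ hmin

/-- Both shadows are weight sums, and the contribution of `C ∩ A` cancels. -/
theorem Stable.card_shadow_le {C : Finset (Fin n → ℕ)} (hn : 3 ≤ n) (hA : Stable r A)
    (hAr : ∀ x ∈ A, rank x = r) (hC : IsSeg r C) (hc : C.card = A.card) :
    (shadow C).card ≤ (shadow A).card := by
  rw [card_shadow_eq_sum_weight fun q hq z hz => hA.lift_mem hn hAr hq hz,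
    card_shadow_eq_sum_weight fun q hq z hz => hC.lift_mem hq hz]
  have hcard : (C \ A).card = (A \ C).card := Finset.card_sdiff_comm hc
  suffices h : ∑ x ∈ C \ A, weight x ≤ ∑ y ∈ A \ C, weight y by
    rw [← Finset.sum_inter_add_sum_sdiff C A, ← Finset.sum_inter_add_sum_sdiff A C,
      Finset.inter_comm A C]
    exact Nat.add_le_add_left h _
  rcases lt_trichotomy r n with hr | rfl | hr
  · refine sum_le_sum_of_forall_le hcard fun x hx y hy => ?_
    rw [Finset.mem_sdiff] at hx hy
    obtain ⟨m, h⟩ := exists_gap hA (hC.1 x hx.1) (hAr y hy.1) hx.2 hy.1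
      ((lt_or_lt_of_ne (x := x) (y := y) (by rintro rfl; exact hx.2 hy.1)).resolve_right
        fun h => hy.2 (hC.2 x hx.1 y (hAr y hy.1) h))
    exact h.weight_le hn hr
  · exact sum_weight_le_of_full_rank hn hA hAr hC hc
  · refine sum_le_sum_of_forall_le hcard fun x hx => ?_
    have h1 := card_zeros_add_rank x
    have h2 := hC.1 x (Finset.mem_sdiff.1 hx).1
    omega

end

/-! ### Slices along a coordinate -/

variable {n r : ℕ}

/-- The point `q` with the value `v` inserted at position `i`. -/
def ins (i : Fin (n + 1)) (v : ℕ) (q : Fin n → ℕ) : Fin (n + 1) → ℕ :=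
  Fin.insertNth (α := fun _ => ℕ) i v q

/-- The point `x` with coordinate `i` dropped. -/
def del (i : Fin (n + 1)) (x : Fin (n + 1) → ℕ) : Fin n → ℕ := fun j => x (i.succAbove j)

@[simp] theorem ins_self (i : Fin (n + 1)) (v : ℕ) (q : Fin n → ℕ) : ins i v q i = v :=
  Fin.insertNth_apply_same (α := fun _ => ℕ) i v q

@[simp] theorem ins_succAbove (i : Fin (n + 1)) (v : ℕ) (q : Fin n → ℕ) (j : Fin n) :
    ins i v q (i.succAbove j) = q j :=
  Fin.insertNth_apply_succAbove (α := fun _ => ℕ) i v q j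

theorem ext_succAbove (i : Fin (n + 1)) {x y : Fin (n + 1) → ℕ} (h : x i = y i)
    (h' : ∀ j, x (i.succAbove j) = y (i.succAbove j)) : x = y := by
  funext j
  rcases Fin.eq_self_or_eq_succAbove i j with rfl | ⟨k, rfl⟩
  · exact h
  · exact h' k

@[simp] theorem del_ins (i : Fin (n + 1)) (v : ℕ) (q : Fin n → ℕ) : del i (ins i v q) = q := by
  funext j
  simp [del]

@[simp] theorem ins_del (i : Fin (n + 1)) (x : Fin (n + 1) → ℕ) : ins i (x i) (del i x) = x :=
  ext_succAbove i (by simp) fun j => by simp [del]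

theorem ins_injective (i : Fin (n + 1)) (v : ℕ) : Function.Injective (ins i v) :=
  Function.LeftInverse.injective (del_ins i v)

theorem update_ins_self (i : Fin (n + 1)) (v w : ℕ) (q : Fin n → ℕ) :
    Function.update (ins i v q) i w = ins i w q :=
  ext_succAbove i (by simp) fun j => by simp [Fin.succAbove_ne]

theorem update_ins_succAbove (i : Fin (n + 1)) (v w : ℕ) (q : Fin n → ℕ) (j : Fin n) :
    Function.update (ins i v q) (i.succAbove j) w = ins i v (Function.update q j w) := by
  refine ext_succAbove i (by simp [(Fin.succAbove_ne i j).symm]) fun k => ?_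
  by_cases hk : k = j
  · subst hk; simp
  · rw [Function.update_of_ne (fun h => hk (Fin.succAbove_right_injective h)), ins_succAbove,
      ins_succAbove, Function.update_of_ne hk]

theorem rank_ins (i : Fin (n + 1)) (v : ℕ) (q : Fin n → ℕ) :
    rank (ins i v q) = rank q + if v = 0 then 0 else 1 := by
  rw [rank_eq_sum, rank_eq_sum, Fin.sum_univ_succAbove _ i]
  simp [add_comm]

theorem Lt.ins {p q : Fin n → ℕ} (h : Lt p q) (i : Fin (n + 1)) (v : ℕ) :
    Lt (ins i v p) (ins i v q) := by
  obtain ⟨l, hl, h⟩ := h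
  refine ⟨i.succAbove l, by simpa using hl, fun j hj => ?_⟩
  rcases Fin.eq_self_or_eq_succAbove i j with rfl | ⟨k, rfl⟩
  · simp at hj
  · have := h k (by simpa using hj)
    simpa [key_lt_iff, key_le_iff, Fin.succAbove_lt_succAbove_iff] using this

theorem Lt.del {x y : Fin (n + 1) → ℕ} (h : Lt x y) {i : Fin (n + 1)} (hi : x i = y i) :
    Lt (del i x) (del i y) := by
  have hne : GridShadow.del i x ≠ GridShadow.del i y := fun he =>
    h.ne (by rw [← ins_del i x, ← ins_del i y, he, hi])
  refine (lt_or_lt_of_ne hne).resolve_right fun h' => ?_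
  have := h'.ins i (x i)
  rw [ins_del, hi, ins_del] at this
  exact h.asymm this

/-- The points of `A` with value `v` at position `i`, with that position dropped. -/
def slice (A : Finset (Fin (n + 1) → ℕ)) (i : Fin (n + 1)) (v : ℕ) : Finset (Fin n → ℕ) :=
  (A.filter fun x => x i = v).image (del i)

theorem mem_slice {A : Finset (Fin (n + 1) → ℕ)} {i : Fin (n + 1)} {v : ℕ} {q : Fin n → ℕ} :
    q ∈ slice A i v ↔ ins i v q ∈ A := by
  simp only [slice, Finset.mem_image, Finset.mem_filter]
  constructor
  · rintro ⟨x, ⟨hx, rfl⟩, rfl⟩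
    rwa [ins_del]
  · intro h
    exact ⟨_, ⟨h, by simp⟩, by simp⟩

theorem sum_slice {A : Finset (Fin (n + 1) → ℕ)} {i : Fin (n + 1)} {N : ℕ}
    (hN : ∀ x ∈ A, x i < N) (f : (Fin (n + 1) → ℕ) → ℕ) :
    ∑ x ∈ A, f x = ∑ v ∈ Finset.range N, ∑ q ∈ slice A i v, f (ins i v q) := by
  rw [← Finset.sum_fiberwise_of_maps_to (fun x hx => Finset.mem_range.2 (hN x hx)) f]
  refine Finset.sum_congr rfl fun v _ => ?_
  rw [slice, Finset.sum_image]
  · refine Finset.sum_congr rfl fun x hx => ?_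
    rw [← (Finset.mem_filter.1 hx).2, ins_del]
  · intro x hx y hy h
    rw [Finset.mem_coe, Finset.mem_filter] at hx hy
    rw [← ins_del i x, ← ins_del i y, h, hx.2, hy.2]

theorem card_slice {A : Finset (Fin (n + 1) → ℕ)} {i : Fin (n + 1)} {N : ℕ}
    (hN : ∀ x ∈ A, x i < N) : A.card = ∑ v ∈ Finset.range N, (slice A i v).card := by
  simpa using sum_slice hN fun _ => 1

theorem slice_shadow_of_ne_zero (A : Finset (Fin (n + 1) → ℕ)) (i : Fin (n + 1)) {v : ℕ}
    (hv : v ≠ 0) : slice (shadow A) i v = shadow (slice A i v) := by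
  ext q
  simp only [mem_slice, mem_shadow]
  constructor
  · rintro ⟨x, hx, j, hj, h⟩
    rcases Fin.eq_self_or_eq_succAbove i j with rfl | ⟨k, rfl⟩
    · exact absurd (by simpa using (congrFun h j).symm) hv
    · have hxi : x i = v := by
        have := congrFun h i
        rwa [Function.update_of_ne (Fin.succAbove_ne i k).symm, ins_self] at this
      refine ⟨del i x, by rwa [← hxi, ins_del], k, hj, ?_⟩
      apply ins_injective i v
      rw [← update_ins_succAbove, ← hxi, ins_del, h, hxi]
  · rintro ⟨p, hp, k, hk, rfl⟩
    exact ⟨_, hp, i.succAbove k, by simpa using hk, update_ins_succAbove ..⟩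

/-- A zero at `i` in a shadow point was either already present or has just been created from a
nonzero layer. -/
theorem slice_shadow_zero {A : Finset (Fin (n + 1) → ℕ)} {i : Fin (n + 1)} {N : ℕ}
    (hN : ∀ x ∈ A, x i < N) : slice (shadow A) i 0
      = shadow (slice A i 0) ∪ (Finset.Ico 1 N).biUnion (slice A i) := by
  ext q
  simp only [mem_slice, Finset.mem_union, mem_shadow, Finset.mem_biUnion, Finset.mem_Ico]
  constructor
  · rintro ⟨x, hx, j, hj, h⟩
    rcases Fin.eq_self_or_eq_succAbove i j with rfl | ⟨k, rfl⟩
    · refine Or.inr ⟨x j, ⟨by omega, hN x hx⟩, ?_⟩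
      have : q = del j x := by
        apply ins_injective j 0
        rw [← h, ← update_ins_self j (x j), ins_del]
      rwa [this, ins_del]
    · left
      have hxi : x i = 0 := by
        have := congrFun h i
        rwa [Function.update_of_ne (Fin.succAbove_ne i k).symm, ins_self] at this
      have hx0 : ins i 0 (del i x) = x := by rw [← hxi, ins_del]
      refine ⟨del i x, by rwa [hx0], k, hj, ?_⟩
      apply ins_injective i 0
      rw [← update_ins_succAbove, hx0, h]
  · rintro (⟨p, hp, k, hk, rfl⟩ | ⟨v, hv, hq⟩)
    · exact ⟨_, hp, i.succAbove k, by simpa using hk, update_ins_succAbove ..⟩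
    · exact ⟨_, hq, i, by rw [ins_self]; omega, update_ins_self ..⟩

theorem apply_lt_of_mem_shadow {A : Finset (Fin n → ℕ)} {i : Fin n} {N : ℕ}
    (hN : ∀ x ∈ A, x i < N) {q : Fin n → ℕ} (hq : q ∈ shadow A) : q i < N := by
  obtain ⟨x, hx, j, -, rfl⟩ := mem_shadow.1 hq
  have := hN x hx
  rw [Function.update_apply]
  split_ifs <;> omega

/-- Segments form a chain, so a finite nonempty union is its largest member. -/
theorem card_biUnion_le_of_isSeg {ι : Type*} [DecidableEq ι] (s : Finset ι)
    (D : ι → Finset (Fin n → ℕ)) {K : ℕ} (hD : ∀ v ∈ s, IsSeg r (D v))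
    (hK : ∀ v ∈ s, (D v).card ≤ K) : (s.biUnion D).card ≤ K ∧ IsSeg r (s.biUnion D) := by
  induction s using Finset.induction with
  | empty => exact ⟨by simp, by simp, by simp⟩
  | insert a s _ ih =>
    obtain ⟨h1, h2⟩ := ih (fun v hv => hD v (Finset.mem_insert_of_mem hv))
      fun v hv => hK v (Finset.mem_insert_of_mem hv)
    have ha := hD a (Finset.mem_insert_self a s)
    rw [Finset.biUnion_insert]
    rcases ha.subset_or_subset h2 with h | h
    · rw [Finset.union_eq_right.2 h]
      exact ⟨h1, h2⟩
    · rw [Finset.union_eq_left.2 h]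
      exact ⟨hK a (Finset.mem_insert_self a s), ha⟩

theorem IsSeg.card_union_le {C D : Finset (Fin n → ℕ)} (hC : IsSeg r C) (hD : IsSeg r D) {K : ℕ}
    (h : C.card ≤ K) (h' : D.card ≤ K) : (C ∪ D).card ≤ K := by
  rcases hC.subset_or_subset hD with hs | hs
  · rwa [Finset.union_eq_right.2 hs]
  · rwa [Finset.union_eq_left.2 hs]

theorem rank_of_mem_slice {A : Finset (Fin (n + 1) → ℕ)} (hA : ∀ x ∈ A, rank x = r)
    {i : Fin (n + 1)} {v : ℕ} {q : Fin n → ℕ} (hq : q ∈ slice A i v) :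
    rank q = if v = 0 then r else r - 1 := by
  have := hA _ (mem_slice.1 hq)
  rw [rank_ins] at this
  split_ifs at this ⊢ <;> omega

/-! ### Compression -/

/-- Among sets of points of rank `r` in `ℕ^n` of a given size, segments have the least shadows. -/
def SegMinimizes (n : ℕ) : Prop :=
  ∀ (r : ℕ) (A C : Finset (Fin n → ℕ)), (∀ x ∈ A, rank x = r) → IsSeg r C → C.card = A.card →
    (shadow C).card ≤ (shadow A).card

/-- Nonzero layers of the shadow follow from induction. Layer 0 is for `B` a union of nested
segments, hence as small as its largest member, whereas for `A` it is at least as large as each of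
its parts. -/
theorem card_shadow_le_of_slices (ih : SegMinimizes n) {A B : Finset (Fin (n + 1) → ℕ)}
    {i : Fin (n + 1)} {N : ℕ} (hA : ∀ x ∈ A, rank x = r) (hAN : ∀ x ∈ A, x i < N)
    (hBN : ∀ x ∈ B, x i < N) (hB : ∀ v, IsSeg (if v = 0 then r else r - 1) (slice B i v))
    (hc : ∀ v, (slice B i v).card = (slice A i v).card) :
    (shadow B).card ≤ (shadow A).card := by
  rw [card_slice fun q hq => apply_lt_of_mem_shadow hBN hq,
    card_slice fun q hq => apply_lt_of_mem_shadow hAN hq]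
  refine Finset.sum_le_sum fun v _ => ?_
  have hv := ih _ _ _ (fun q => rank_of_mem_slice hA) (hB v) (hc v)
  by_cases hv0 : v = 0
  · subst hv0
    rw [slice_shadow_zero hAN, slice_shadow_zero hBN]
    have hs : IsSeg r (slice B i 0) := hB 0
    obtain ⟨h1, h2⟩ := card_biUnion_le_of_isSeg (r := r - 1) (Finset.Ico 1 N) (slice B i)
      (fun v hv => by
        have := hB v
        rwa [if_neg (by rw [Finset.mem_Ico] at hv; omega)] at this)
      (fun v hv => (hc v).trans_le (Finset.card_le_card
        ((Finset.subset_biUnion_of_mem (slice A i) hv).trans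
          (Finset.subset_union_right (s₁ := shadow (slice A i 0))))))
    exact hs.shadow.card_union_le h2
      (hv.trans (Finset.card_le_card Finset.subset_union_left)) h1
  · rwa [slice_shadow_of_ne_zero _ _ hv0, slice_shadow_of_ne_zero _ _ hv0]

theorem sum_lt_sum_of_forall_lt {α : Type*} {X Y : Finset α} {f : α → ℕ} (h : X.card = Y.card)
    (hY : Y.Nonempty) (hf : ∀ x ∈ X, ∀ y ∈ Y, f x < f y) : ∑ x ∈ X, f x < ∑ y ∈ Y, f y := by
  obtain ⟨y, hy, hmin⟩ := Finset.exists_min_image Y f hY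
  have hX : X.Nonempty := Finset.card_pos.1 (h ▸ Finset.card_pos.2 hY)
  calc ∑ x ∈ X, f x < ∑ _x ∈ X, f y := Finset.sum_lt_sum_of_nonempty hX fun x hx => hf x hx y hy
    _ = Y.card • f y := by rw [Finset.sum_const, h]
    _ ≤ _ := Finset.card_nsmul_le_sum _ _ _ hmin

theorem IsSeg.sum_lt {C B : Finset (Fin n → ℕ)} (hC : IsSeg r C) (hB : ∀ x ∈ B, rank x = r)
    (hc : C.card = B.card) (hne : C ≠ B) {f : (Fin n → ℕ) → ℕ} (hf : ∀ x y, Lt x y → f x < f y) :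
    ∑ x ∈ C, f x < ∑ x ∈ B, f x := by
  rw [← Finset.sum_inter_add_sum_sdiff C B, ← Finset.sum_inter_add_sum_sdiff B C,
    Finset.inter_comm B C]
  refine Nat.add_lt_add_left (sum_lt_sum_of_forall_lt (Finset.card_sdiff_comm hc) ?_ ?_) _
  · rw [Finset.sdiff_nonempty]
    exact fun hs => hne (Finset.eq_of_subset_of_card_le hs hc.le).symm
  · intro x hx y hy
    rw [Finset.mem_sdiff] at hx hy
    exact hf x y ((lt_or_lt_of_ne (by rintro rfl; exact hx.2 hy.1)).resolve_right
      fun h => hy.2 (hC.2 x hx.1 y (hB y hy.1) h))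

theorem exists_compression (ih : SegMinimizes n) {A : Finset (Fin (n + 1) → ℕ)}
    (hA : ∀ x ∈ A, rank x = r) (hs : ¬ Stable r A) :
    ∃ B : Finset (Fin (n + 1) → ℕ), (∀ x ∈ B, rank x = r) ∧ B.card = A.card ∧
      (shadow B).card ≤ (shadow A).card ∧ ∑ x ∈ B, code x < ∑ x ∈ A, code x := by
  simp only [Stable, not_forall] at hs
  obtain ⟨y, hy, x, hx, hxy, ⟨i, hi⟩, hxA⟩ := hs
  obtain ⟨N, hN⟩ : ∃ N, ∀ x ∈ A, x i < N := by
    obtain ⟨M, hM⟩ := (A.image fun x => x i).bddAbove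
    exact ⟨M + 1, fun x hx => Nat.lt_succ_of_le (hM (by simpa using ⟨x, hx, rfl⟩))⟩
  choose D hD hDc using fun v => exists_isSeg (slice A i v) (fun q => rank_of_mem_slice hA)
  set B := (Finset.range N).biUnion fun v => (D v).image (ins i v) with hB
  have hDN : ∀ v, ∀ q ∈ D v, v < N := by
    intro v q hq
    have : 0 < (slice A i v).card := hDc v ▸ Finset.card_pos.2 ⟨q, hq⟩
    obtain ⟨p, hp⟩ := Finset.card_pos.1 this
    simpa using hN _ (mem_slice.1 hp)
  have hBs : ∀ v, slice B i v = D v := by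
    intro v
    ext q
    simp only [mem_slice, hB, Finset.mem_biUnion, Finset.mem_range, Finset.mem_image]
    constructor
    · rintro ⟨w, -, p, hp, h⟩
      have h1 := congrFun h i
      have h2 := congrArg (del i) h
      simp only [ins_self, del_ins] at h1 h2
      rwa [← h1, ← h2]
    · exact fun hq => ⟨v, hDN v q hq, q, hq, rfl⟩
  have hBN : ∀ x ∈ B, x i < N := by
    intro x hx
    simp only [hB, Finset.mem_biUnion, Finset.mem_range, Finset.mem_image] at hx
    obtain ⟨v, hv, q, -, rfl⟩ := hx
    simpa using hv
  have hc : ∀ v, (slice B i v).card = (slice A i v).card := fun v => by rw [hBs, hDc]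
  refine ⟨B, fun z hz => ?_, ?_, ?_, ?_⟩
  · rw [← ins_del i z, ← mem_slice, hBs] at hz
    have h1 := (hD _).1 _ hz
    -- A genuine point of the slice of `A` supplies the rank identity, which the truncated `r - 1`
    -- alone would not give.
    obtain ⟨p, hp⟩ := Finset.card_pos.1 (hDc _ ▸ Finset.card_pos.2 ⟨_, hz⟩)
    have h2 := hA _ (mem_slice.1 hp)
    have h3 := rank_of_mem_slice hA hp
    rw [rank_ins, h3, ← h1, ← rank_ins, ins_del] at h2
    exact h2
  · rw [card_slice hBN, card_slice hN]
    exact Finset.sum_congr rfl fun v _ => hc v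
  · exact card_shadow_le_of_slices ih hA hN hBN (fun v => hBs v ▸ hD v) hc
  · rw [sum_slice hBN, sum_slice hN]
    have hmono : ∀ v, ∀ p q : Fin n → ℕ, Lt p q → code (ins i v p) < code (ins i v q) :=
      fun v p q h => code_lt_of_lt (h.ins i v)
    have hstrict : ∀ v, slice B i v ≠ slice A i v → ∑ q ∈ slice B i v, code (ins i v q)
        < ∑ q ∈ slice A i v, code (ins i v q) := fun v hne =>
      (hBs v ▸ hD v : IsSeg _ (slice B i v)).sum_lt (fun q => rank_of_mem_slice hA) (hc v) hne
        (hmono v)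
    refine Finset.sum_lt_sum (fun v _ => ?_)
      ⟨y i, Finset.mem_range.2 (hN y hy), hstrict _ fun he => ?_⟩
    · by_cases he : slice B i v = slice A i v
      · rw [he]
      · exact (hstrict v he).le
    -- Were the slice through `y` unchanged, it would be a segment and would contain `x` with
    -- coordinate `i` dropped, contradicting `x ∉ A`.
    · have hseg := hD (y i)
      rw [← hBs, he] at hseg
      have hyq : del i y ∈ slice A i (y i) := by rwa [mem_slice, ins_del]
      refine hxA ?_
      rw [← ins_del i x, ← mem_slice, hi]
      refine hseg.2 _ hyq _ ?_ (hxy.del hi)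
      have h1 := hseg.1 _ hyq
      have h2 := hA y hy
      rw [← ins_del i y, rank_ins] at h2
      rw [← ins_del i x, rank_ins, hi] at hx
      omega

/-! ### Rank at most one, and the plane -/

theorem card_shadow_le_of_rank_le_one (hr : r ≤ 1) {A C : Finset (Fin n → ℕ)}
    (hA : ∀ x ∈ A, rank x = r) (hC : ∀ x ∈ C, rank x = r) (hc : C.card = A.card) :
    (shadow C).card ≤ (shadow A).card := by
  have hzero : ∀ D : Finset (Fin n → ℕ), (∀ x ∈ D, rank x = r) → ∀ q ∈ shadow D, q = 0 := by
    intro D hD q hq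
    have h0 : rank q = 0 := by have := rank_of_mem_shadow hD hq; omega
    rw [rank_eq, Finset.card_eq_zero, Finset.filter_eq_empty_iff] at h0
    funext j
    simpa using h0 (Finset.mem_univ j)
  rcases (shadow C).eq_empty_or_nonempty with h | ⟨q, hq⟩
  · simp [h]
  · have h1 : (shadow C).card ≤ 1 := Finset.card_le_one.2 fun a ha b hb => by
      rw [hzero C hC a ha, hzero C hC b hb]
    obtain ⟨x, hx, -⟩ := mem_shadow.1 hq
    obtain ⟨y, hy⟩ := Finset.card_pos.1 (hc ▸ Finset.card_pos.2 ⟨x, hx⟩)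
    have hr1 : rank y = 1 := by
      have := rank_of_mem_shadow hC hq
      have := hA y hy
      omega
    obtain ⟨j, hj⟩ := Finset.card_pos.1 (show 0 < (Finset.univ.filter fun j => y j ≠ 0).card by
      rw [← rank_eq]; omega)
    refine h1.trans (Finset.card_pos.2 ⟨Function.update y j 0, mem_shadow.2 ⟨y, hy, j, ?_, rfl⟩⟩)
    simpa using hj

theorem update_two_zero (x : Fin 2 → ℕ) : Function.update x 0 0 = ![0, x 1] := by
  funext j; fin_cases j <;> simp

theorem update_two_one (x : Fin 2 → ℕ) : Function.update x 1 0 = ![x 0, 0] := by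
  funext j; fin_cases j <;> simp

theorem rank_two_iff {x : Fin 2 → ℕ} : rank x = 2 ↔ x 0 ≠ 0 ∧ x 1 ≠ 0 := by
  rw [rank_eq_sum, Fin.sum_univ_two]
  split_ifs <;> simp_all

/-- Take `a` and `b` to be the sizes of the two projections: `A` lies in their product, and the
shadow consists of a disjoint copy of each on the axes. -/
theorem exists_card_shadow_two {A : Finset (Fin 2 → ℕ)} (hA : ∀ x ∈ A, rank x = 2) :
    ∃ a b, A.card ≤ a * b ∧ (shadow A).card = a + b := by
  have hA' := fun x hx => rank_two_iff.1 (hA x hx)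
  refine ⟨(A.image fun x => x 0).card, (A.image fun x => x 1).card, ?_, ?_⟩
  · rw [← Finset.card_product]
    refine Finset.card_le_card_of_injOn (fun x => (x 0, x 1)) (fun x hx => ?_) ?_
    · simp only [Finset.coe_product, Set.mem_prod, Finset.mem_coe]
      exact ⟨Finset.mem_image_of_mem _ hx, Finset.mem_image_of_mem _ hx⟩
    · intro x _ y _ h
      rw [Prod.mk.injEq] at h
      funext j
      fin_cases j
      exacts [h.1, h.2]
  · have hs : shadow A = (A.image fun x => x 0).image (fun a => ![a, 0])
        ∪ (A.image fun x => x 1).image (fun b => ![0, b]) := by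
      ext q
      simp only [mem_shadow, Fin.exists_fin_two, update_two_zero, update_two_one,
        Finset.mem_union, Finset.mem_image]
      constructor
      · rintro ⟨x, hx, ⟨-, rfl⟩ | ⟨-, rfl⟩⟩
        · exact Or.inr ⟨_, ⟨x, hx, rfl⟩, rfl⟩
        · exact Or.inl ⟨_, ⟨x, hx, rfl⟩, rfl⟩
      · rintro (⟨_, ⟨x, hx, rfl⟩, rfl⟩ | ⟨_, ⟨x, hx, rfl⟩, rfl⟩)
        · exact ⟨x, hx, Or.inr ⟨(hA' x hx).2, rfl⟩⟩
        · exact ⟨x, hx, Or.inl ⟨(hA' x hx).1, rfl⟩⟩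
    have h0 : Function.Injective fun a : ℕ => ![a, 0] := fun a b h => by simpa using congrFun h 0
    have h1 : Function.Injective fun b : ℕ => ![0, b] := fun a b h => by simpa using congrFun h 1
    rw [hs, Finset.card_union_of_disjoint, Finset.card_image_of_injective _ h0,
      Finset.card_image_of_injective _ h1]
    · rw [Finset.disjoint_left]
      intro q hq hq'
      simp only [Finset.mem_image] at hq hq'
      obtain ⟨_, ⟨x, hx, rfl⟩, rfl⟩ := hq
      obtain ⟨_, ⟨y, -, rfl⟩, h⟩ := hq'
      have := congrFun h 0
      simp only [Matrix.cons_val_zero] at this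
      exact (hA' x hx).1 this.symm

theorem card_shadow_two_le {C : Finset (Fin 2 → ℕ)} {p q : ℕ} (hC : ∀ x ∈ C, rank x = 2)
    (h : ∀ x ∈ C, x 0 ≤ p ∧ x 1 ≤ q) : (shadow C).card ≤ p + q := by
  have hs : shadow C ⊆ (Finset.Icc 1 p).image (fun a => ![a, 0])
      ∪ (Finset.Icc 1 q).image (fun b => ![0, b]) := by
    intro y hy
    simp only [mem_shadow, Fin.exists_fin_two, update_two_zero, update_two_one] at hy
    simp only [Finset.mem_union, Finset.mem_image, Finset.mem_Icc]
    obtain ⟨x, hx, ⟨-, rfl⟩ | ⟨-, rfl⟩⟩ := hy <;> have h1 := rank_two_iff.1 (hC x hx) <;>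
      have h2 := h x hx
    · exact Or.inr ⟨_, ⟨by omega, h2.2⟩, rfl⟩
    · exact Or.inl ⟨_, ⟨by omega, h2.1⟩, rfl⟩
  refine (Finset.card_le_card hs).trans ((Finset.card_union_le _ _).trans (Nat.add_le_add ?_ ?_))
    <;> exact Finset.card_image_le.trans (by simp)

/-- The box of positive points below `c` lies in `C`, and `c` itself lies outside it; hence the
strict inequality. -/
theorem IsSeg.lt_card_two {C : Finset (Fin 2 → ℕ)} (hC : IsSeg 2 C) {c : Fin 2 → ℕ} (hc : c ∈ C)
    {p q : ℕ} (h : ∀ x : Fin 2 → ℕ, x 0 ≤ p → x 1 ≤ q → Lt x c) : p * q < C.card := by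
  set D := (Finset.Icc 1 p ×ˢ Finset.Icc 1 q).image fun z : ℕ × ℕ => ![z.1, z.2] with hD
  have hDc : D.card = p * q := by
    rw [hD, Finset.card_image_of_injective]
    · simp
    · intro a b h
      exact Prod.ext (by simpa using congrFun h 0) (by simpa using congrFun h 1)
  have hDlt : ∀ x ∈ D, rank x = 2 ∧ Lt x c := by
    intro x hx
    simp only [hD, Finset.mem_image, Finset.mem_product, Finset.mem_Icc] at hx
    obtain ⟨⟨a, b⟩, ⟨⟨h1, h2⟩, h3, h4⟩, rfl⟩ := hx
    exact ⟨rank_two_iff.2 ⟨by simpa using by omega, by simpa using by omega⟩,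
      h _ (by simpa using h2) (by simpa using h4)⟩
  rw [← hDc]
  refine Finset.card_lt_card ((Finset.ssubset_iff_of_subset fun x hx =>
    hC.2 c hc x (hDlt x hx).1 (hDlt x hx).2).2 ⟨c, hc, fun hcD => (hDlt c hcD).2.ne rfl⟩)

theorem card_shadow_le_two {A C : Finset (Fin 2 → ℕ)} (hA : ∀ x ∈ A, rank x = 2)
    (hC : IsSeg 2 C) (hc : C.card = A.card) : (shadow C).card ≤ (shadow A).card := by
  rcases C.eq_empty_or_nonempty with rfl | hne
  · simp [shadow]
  obtain ⟨c, hcC, hmax⟩ := Finset.exists_max_image C code hne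
  have hmax' : ∀ x ∈ C, ¬ Lt c x := fun x hx h => (hmax x hx).not_gt (code_lt_of_lt h)
  obtain ⟨a, b, hab, hs⟩ := exists_card_shadow_two hA
  have hc0 := rank_two_iff.1 (hC.1 c hcC)
  rw [hs]
  by_contra! hlt
  -- Plane segments fill squares. If the last point `c` has `c 0 = t + 1 > c 1`, then `C` has more
  -- than `t * t` points and fits in a `(t + 1) × t` box. If `c 1 = t + 1 ≥ c 0`, it has more than
  -- `(t + 1) * t` points and fits in a square of side `t + 1`. The bound on `a + b` is then the
  -- arithmetic-geometric mean inequality for integers.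
  rcases lt_or_ge (c 1) (c 0) with h | h
  · obtain ⟨t, ht⟩ : ∃ t, c 0 = t + 1 := ⟨c 0 - 1, by omega⟩
    have hup : (shadow C).card ≤ (t + 1) + t := card_shadow_two_le hC.1 fun x hx => by
      by_contra hcon
      rcases lt_or_ge t (x 1) with h1 | h1
      · rcases le_or_gt (x 0) (x 1) with h2 | h2
        · refine hmax' x hx ⟨1, by omega, ?_⟩
          simp only [Fin.forall_fin_two, key_lt_iff, key_le_iff]
          grind
        · refine hmax' x hx ⟨0, by omega, ?_⟩
          simp only [Fin.forall_fin_two, key_lt_iff, key_le_iff]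
          grind
      · refine hmax' x hx ⟨0, by omega, ?_⟩
        simp only [Fin.forall_fin_two, key_lt_iff, key_le_iff]
        grind
    have hlow : t * t < C.card := hC.lt_card_two hcC fun x h0 h1 => by
      refine ⟨0, by omega, ?_⟩
      simp only [Fin.forall_fin_two, key_lt_iff, key_le_iff]
      grind
    zify at *
    nlinarith [sq_nonneg ((a : ℤ) - b)]
  · obtain ⟨t, ht⟩ : ∃ t, c 1 = t + 1 := ⟨c 1 - 1, by omega⟩
    have hup : (shadow C).card ≤ (t + 1) + (t + 1) := card_shadow_two_le hC.1 fun x hx => by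
      by_contra hcon
      rcases le_or_gt (x 0) (x 1) with h2 | h2
      · refine hmax' x hx ⟨1, by omega, ?_⟩
        simp only [Fin.forall_fin_two, key_lt_iff, key_le_iff]
        grind
      · refine hmax' x hx ⟨0, by omega, ?_⟩
        simp only [Fin.forall_fin_two, key_lt_iff, key_le_iff]
        grind
    have hlow : (t + 1) * t < C.card := hC.lt_card_two hcC fun x h0 h1 => by
      refine ⟨1, by omega, ?_⟩
      simp only [Fin.forall_fin_two, key_lt_iff, key_le_iff]
      grind
    have h1 : a + b ≤ 2 * t + 1 := by omega
    have h2 : (t + 1) * t < a * b := by omega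
    rcases le_or_gt a t with h3 | h3
    · obtain ⟨d, rfl⟩ := Nat.exists_eq_add_of_le h3
      nlinarith
    · obtain ⟨d, rfl⟩ := Nat.exists_eq_add_of_lt h3
      nlinarith

/-! ### The induction on dimension -/

theorem segMinimizes (n : ℕ) : SegMinimizes n := by
  induction n with
  | zero =>
    intro r A C _ _ _
    have : shadow C = ∅ := Finset.eq_empty_of_forall_notMem fun q hq => by
      obtain ⟨j, -⟩ := exists_eq_zero_of_mem_shadow hq
      exact j.elim0
    simp [this]
  | succ n ih =>
    intro r A C hA hC hc
    rcases Nat.lt_or_ge (n + 1) r with hr | hr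
    · have : C = ∅ := Finset.eq_empty_of_forall_notMem fun x hx => by
        have h1 := card_zeros_add_rank x
        have h2 := hC.1 x hx
        omega
      simp [this, shadow]
    rcases Nat.lt_or_ge 1 r with hr1 | hr1
    swap
    · exact card_shadow_le_of_rank_le_one hr1 hA hC.1 hc
    rcases Nat.lt_or_ge 1 n with hn | hn
    swap
    · obtain rfl : n = 1 := by omega
      obtain rfl : r = 2 := by omega
      exact card_shadow_le_two hA hC hc
    -- The sum of codes is the measure that makes repeated compression terminate at a stable set.
    induction hs : ∑ x ∈ A, code x using Nat.strong_induction_on generalizing A with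
    | _ s IH =>
      by_cases hst : Stable r A
      · exact hst.card_shadow_le (by omega) hA hC hc
      · obtain ⟨B, hB, hBc, hBs, hlt⟩ := exists_compression ih hA hst
        exact (IH _ (hs ▸ hlt) B hB (hc.trans hBc.symm) rfl).trans hBs

end GridShadow

theorem theorem2 (n r : ℕ) :
    -- subsets of `[k]^n_r`
    (∀ k : ℕ, ∀ A : Finset (Fin n → ℕ), A ⊆ GridShadow.grid k n r →
      (∃! B : Finset (Fin n → ℕ),
        GridShadow.IsInitialSegment ↑(GridShadow.grid k n r) B ∧ B.card = A.card) ∧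
      ∀ B : Finset (Fin n → ℕ),
        GridShadow.IsInitialSegment ↑(GridShadow.grid k n r) B → B.card = A.card →
          (GridShadow.shadow B).card ≤ (GridShadow.shadow A).card) ∧
    -- finite subsets of `ℕ^n_r`
    (∀ A : Finset (Fin n → ℕ), ↑A ⊆ GridShadow.natGrid n r →
      (∃! C : Finset (Fin n → ℕ),
        GridShadow.IsInitialSegment (GridShadow.natGrid n r) C ∧ C.card = A.card) ∧
      ∀ C : Finset (Fin n → ℕ),
        GridShadow.IsInitialSegment (GridShadow.natGrid n r) C → C.card = A.card →
          (GridShadow.shadow C).card ≤ (GridShadow.shadow A).card) ∧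
    -- the sets `[t]^n_r` are initial segments and extremal
    (∀ t : ℕ,
      GridShadow.IsInitialSegment (GridShadow.natGrid n r) (GridShadow.grid t n r) ∧
      (∀ k : ℕ, t ≤ k →
        GridShadow.IsInitialSegment ↑(GridShadow.grid k n r) (GridShadow.grid t n r)) ∧
      ∀ A : Finset (Fin n → ℕ), ↑A ⊆ GridShadow.natGrid n r →
        A.card = (GridShadow.grid t n r).card →
          (GridShadow.shadow (GridShadow.grid t n r)).card ≤ (GridShadow.shadow A).card) := by
  simp only [GridShadow.isInitialSegment_natGrid_iff, GridShadow.isInitialSegment_grid_iff]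
  have hmin := GridShadow.segMinimizes n r
  refine ⟨fun k A hA => ?_, fun A hA => ?_, fun t => ⟨GridShadow.isSeg_grid t n r, fun k hk =>
    ⟨GridShadow.isSeg_grid t n r, fun x hx => ?_⟩, fun A hA hc =>
      hmin A _ (fun x hx => hA hx) (GridShadow.isSeg_grid t n r) hc.symm⟩⟩
  · have hr : ∀ x ∈ A, GridShadow.rank x = r := fun x hx => (GridShadow.mem_grid.1 (hA hx)).2
    obtain ⟨C, hC, hc⟩ := GridShadow.exists_isSeg A hr
    refine ⟨⟨C, ⟨⟨hC, hC.subset_of_card_le (GridShadow.isSeg_grid k n r)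
      (hc.trans_le (Finset.card_le_card hA))⟩, hc⟩, fun D hD => ?_⟩,
      fun B hB hBc => hmin A B hr hB.1 hBc⟩
    exact hD.1.1.eq_of_card_eq hC (hD.2.trans hc.symm)
  · obtain ⟨C, hC, hc⟩ := GridShadow.exists_isSeg A fun x hx => hA hx
    exact ⟨⟨C, ⟨hC, hc⟩, fun D hD => hD.1.eq_of_card_eq hC (hD.2.trans hc.symm)⟩,
      fun B hB hBc => hmin A B (fun x hx => hA hx) hB hBc⟩
  · rw [GridShadow.mem_grid] at hx ⊢
    exact ⟨fun j => (hx.1 j).trans_le hk, hx.2⟩
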